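/- **Definitions.** A one-parameter unitary group on a separable Hilbert space $\mathcal H$ is a group homomorphism $t\mapsto u(t)$ from $\mathbb R$ into the unitary operators on $\mathcal H$ that is continuous in the strong operator topology. Representations of $\mathcal B(\mathcal H)$ are unital $*$-representations. Such a representation $\pi\colon\mathcal B(\mathcal H)\to\mathcal B(\mathcal L)$ has *infinite multiplicity* if there are an infinite-dimensional Hilbert space $\mathcal F$ and a unitary $W\colon\mathcal L\to\mathcal H\otimes\mathcal F$ with $\pi(a)=W^*(a\otimes 1)W$ for all $a$. Two $d$-tuples $u=(u_1,\dots,u_d)$ on $\mathcal H$ and $v=(v_1,\dots,v_d)$ on $\mathcal K$ of one-parameter unitary groups are *equivalent*, $u\sim v$, if there are faithful normal representations $\pi$ of $\mathcal B(\mathcal H)$ and $\rho$ of $\mathcal B(\mathcal K)$ on one Hilbert space such that $\pi(u_k(t))=\rho(v_k(t))$ for all $k$ and all $t\in\mathbb R$. For a real number $c>0$ write $u\prec_c v$ if there are separable Hilbert spaces $\mathcal H\subseteq\mathcal K$, $d$-tuples $U$ on $\mathcal H$ and $V$ on $\mathcal K$ of one-parameter unitary groups with $u\sim U$ and $v\sim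 V$, and real constants $C(t)\le e^{ct^2}$ (not depending on $k$), such that $U_k(t)=P_{\mathcal H}\,C(t)V_k(t)|_{\mathcal H}$ for all $k$ and all $t$ in a neighborhood of $0$. The *dilation distance* is $$d_{\mathrm D}(u,v)=\max\bigl(\inf\{c>0: u\prec_c v\},\ \inf\{c>0: v\prec_c u\}\bigr)\in[0,\infty],\qquad \inf\emptyset=\infty .$$ **Theorem.** Let $u=(u_1,\dots,u_d)$ and $v=(v_1,\dots,v_d)$ be $d$-tuples of one-parameter unitary groups on separable Hilbert spaces $\mathcal H_1$ and $\mathcal H_2$, and let $0<\delta<\infty$. If $d_{\mathrm D}(u,v)\le\delta$, then there exist a separable Hilbert space $\mathcal L$ and faithful normal representations $\pi\colon\mathcal B(\mathcal H_1)\to\mathcal B(\mathcal L)$ and $\rho\colon\mathcal B(\mathcal H_2)\to\mathcal B(\mathcal L)$ of infinite multiplicity such that $$\|\pi(u_k(t))-\rho(v_k(t))\|\le 5\sqrt2\,|t|\,\delta^{1/2}$$ for all $k=1,\dots,d$ and all $t\in\mathbb R$ (in particular for all $t$ in a neighborhood of $0$). -/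

import Mathlib

open scoped ENNReal

noncomputable section

/-- A strongly continuous one-parameter unitary group on the Hilbert space `H`: a group
homomorphism from `(ℝ, +)` to the unitary operators such that every orbit map is continuous. -/
structure OneParamUnitaryGroup (H : Type*) [NormedAddCommGroup H] [InnerProductSpace ℂ H]
    [CompleteSpace H] where
  toHom : Multiplicative ℝ →* unitary (H →L[ℂ] H)
  strongly_continuous : ∀ x : H,
    Continuous fun t : ℝ => (toHom (Multiplicative.ofAdd t) : H →L[ℂ] H) x

/-- The unitary operator `u(t)`. -/
def OneParamUnitaryGroup.op {H : Type*} [NormedAddCommGroup H] [InnerProductSpace ℂ H]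
    [CompleteSpace H] (u : OneParamUnitaryGroup H) (t : ℝ) : H →L[ℂ] H :=
  (u.toHom (Multiplicative.ofAdd t) : H →L[ℂ] H)

/-- A (unital `*`-) representation of `B(H)` on `L` is normal if it preserves suprema of
bounded increasing nets of selfadjoint operators (with respect to the Loewner order). -/
def IsNormalRep {H L : Type*} [NormedAddCommGroup H] [InnerProductSpace ℂ H] [CompleteSpace H]
    [NormedAddCommGroup L] [InnerProductSpace ℂ L] [CompleteSpace L]
    (π : (H →L[ℂ] H) →⋆ₐ[ℂ] (L →L[ℂ] L)) : Prop :=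
  ∀ (S : Set (H →L[ℂ] H)) (a : H →L[ℂ] H), (∀ s ∈ S, IsSelfAdjoint s) → S.Nonempty →
    DirectedOn (· ≤ ·) S → IsLUB S a → IsLUB (π '' S) (π a)

/-- A faithful normal representation of `B(H)` on `L`. -/
def IsFaithfulNormalRep {H L : Type*} [NormedAddCommGroup H] [InnerProductSpace ℂ H]
    [CompleteSpace H] [NormedAddCommGroup L] [InnerProductSpace ℂ L] [CompleteSpace L]
    (π : (H →L[ℂ] H) →⋆ₐ[ℂ] (L →L[ℂ] L)) : Prop :=
  Function.Injective π ∧ IsNormalRep π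

/-- A representation of `B(H)` on `L` has infinite multiplicity if it is unitarily equivalent to
`a ↦ a ⊗ 1` on `H ⊗ ℓ²(ι)` for some infinite index set `ι`, where `H ⊗ ℓ²(ι)` is realised as the
Hilbert space `ℓ²(ι, H)` of square-summable families, on which `a ⊗ 1` acts coordinatewise. -/
def HasInfiniteMultiplicity {H L : Type*} [NormedAddCommGroup H] [InnerProductSpace ℂ H]
    [CompleteSpace H] [NormedAddCommGroup L] [InnerProductSpace ℂ L] [CompleteSpace L]
    (π : (H →L[ℂ] H) →⋆ₐ[ℂ] (L →L[ℂ] L)) : Prop :=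
  ∃ (ι : Type) (_ : Infinite ι) (W : L ≃ₗᵢ[ℂ] lp (fun _ : ι => H) 2),
    ∀ (a : H →L[ℂ] H) (x : L) (i : ι), W (π a x) i = a (W x i)

/-- Equivalence `u ∼ v` of two tuples of one-parameter unitary groups. All unitary groups live on
separable Hilbert spaces, and every separable Hilbert space is isometrically isomorphic to one in
`Type`, so that it is enough to look for the common representation space there. -/
def TupleEquiv {H K : Type*} [NormedAddCommGroup H] [InnerProductSpace ℂ H] [CompleteSpace H]
    [NormedAddCommGroup K] [InnerProductSpace ℂ K] [CompleteSpace K] {d : ℕ}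
    (u : Fin d → OneParamUnitaryGroup H) (v : Fin d → OneParamUnitaryGroup K) : Prop :=
  ∃ (L : Type) (_ : NormedAddCommGroup L) (_ : InnerProductSpace ℂ L) (_ : CompleteSpace L)
    (π : (H →L[ℂ] H) →⋆ₐ[ℂ] (L →L[ℂ] L)) (ρ : (K →L[ℂ] K) →⋆ₐ[ℂ] (L →L[ℂ] L)),
    IsFaithfulNormalRep π ∧ IsFaithfulNormalRep ρ ∧
      ∀ (k : Fin d) (t : ℝ), π ((u k).op t) = ρ ((v k).op t)

/-- `u ≺_c v`: there are a separable Hilbert space `K`, a closed subspace `M` of `K`, and tuples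
`U ∼ u` on `M` and `V ∼ v` on `K` such that `U_k(t)` is `C(t)` times the compression of `V_k(t)`
to `M`, for all `k` and all `t` near `0`, with real constants `C(t) ≤ exp(c t²)`. -/
def DilatesWith {H₁ H₂ : Type*} [NormedAddCommGroup H₁] [InnerProductSpace ℂ H₁]
    [CompleteSpace H₁] [NormedAddCommGroup H₂] [InnerProductSpace ℂ H₂] [CompleteSpace H₂] {d : ℕ}
    (c : ℝ) (u : Fin d → OneParamUnitaryGroup H₁) (v : Fin d → OneParamUnitaryGroup H₂) : Prop :=
  ∃ (K : Type) (_ : NormedAddCommGroup K) (_ : InnerProductSpace ℂ K) (_ : CompleteSpace K)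
    (_ : TopologicalSpace.SeparableSpace K) (M : Submodule ℂ K) (_ : CompleteSpace M)
    (U : Fin d → OneParamUnitaryGroup M) (V : Fin d → OneParamUnitaryGroup K) (C : ℝ → ℝ),
    TupleEquiv u U ∧ TupleEquiv v V ∧
      ∀ᶠ t in nhds (0 : ℝ), C t ≤ Real.exp (t ^ 2 * c) ∧
        ∀ (k : Fin d) (x : M),
          (U k).op t x = M.orthogonalProjectionOnto ((C t : ℂ) • (V k).op t (x : K))

/-- The dilation distance
`d_D(u,v) = max (inf {c > 0 : u ≺_c v}) (inf {c > 0 : v ≺_c u})`, with `inf ∅ = ∞`. -/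
def dilationDist {H₁ H₂ : Type*} [NormedAddCommGroup H₁] [InnerProductSpace ℂ H₁]
    [CompleteSpace H₁] [NormedAddCommGroup H₂] [InnerProductSpace ℂ H₂] [CompleteSpace H₂] {d : ℕ}
    (u : Fin d → OneParamUnitaryGroup H₁) (v : Fin d → OneParamUnitaryGroup H₂) : ℝ≥0∞ :=
  max (⨅ (c : ℝ) (_ : 0 < c ∧ DilatesWith c u v), ENNReal.ofReal c)
    (⨅ (c : ℝ) (_ : 0 < c ∧ DilatesWith c v u), ENNReal.ofReal c)

end

/-!
Write `u ⊗ 1` for the tuple `u` acting on `H ⊗ ℓ²(ℕ)`, realised as `ℓ²(ℕ, H)`.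

*Reduction to ampliations.* A normal representation of `B(H)` is a multiple of the identity
representation (`IsNormalRep.exists_isHilbertSum`). A vector of a Hilbert sum involves only
countably many summands, so in a space which is at the same time a multiple of `H` and a multiple of
`K`, with `H` and `K` separable, there is a nonzero subspace which is a countable multiple of both
(`IsHilbertSum.exists_countable_closure_eq`). Hence `u ∼ v` makes `u ⊗ 1` and `v ⊗ 1` unitarily
equivalent (`TupleEquiv.exists_unitary`). Conversely `a ↦ a ⊗ 1` is a faithful normal
representation of infinite multiplicity (`isNormalRep_of_lp`), so that the theorem asks for a
unitary operator `T` with `‖T (u_k(t) ⊗ 1) - (v_k(t) ⊗ 1) T‖ ≤ 5 √2 |t| √δ`.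

*Near invariance.* Let `U_k(t)` be `C(t)` times the compression of `V_k(t)` to `M ⊆ K`, with
`C(t) ≤ exp(c t²)`. The compression being `C(t)⁻¹` times a unitary operator, `V_k(t)`
maps a unit vector of `M` to a vector whose component in `Mᗮ` has norm
`√(1 - C(t)⁻²) ≤ √(2c) |t|` when `t` is small. The same holds for `V_k(-t) = V_k(t)*`, so that both
off-diagonal blocks of `V_k(t)` have norm at most `√(2c) |t|`, while the diagonal block at `M`
differs from `U_k(t)` only by `1 - C(t)⁻¹ ≤ c t²` (`eventually_norm_compression_le`).

*Absorption.* For operators `D` which are block diagonal with respect to `K = M ⊕ Mᗮ`, an Eilenberg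
swindle gives a unitary operator `absorb M` carrying `D ⊗ 1` to `(D|_M ⊗ 1) ⊕ (D ⊗ 1)`. Applied to
`V_k(t)`, it carries `V_k(t) ⊗ 1` to `(U_k(t) ⊗ 1) ⊕ (V_k(t) ⊗ 1)` up to an error
`2 √(2c) |t| + c t²` (`norm_absorb_sub_le`). As the error is subadditive in time, the second-order
term disappears when the estimate is extended from small to arbitrary `t`
(`norm_intertwine_le_of_eventually`).

*Conclusion.* If `u ≺_c v` and `v ≺_c u`, then `u ⊗ 1` and `v ⊗ 1` are both close to
`(u ⊗ 1) ⊕ (v ⊗ 1)`, within any `ε |t|` with `ε > 2 √(2c)` (`nearlyConj_of_dilatesWith`). Their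
mutual distance is thus about `4 √2 √c |t|`, and `c` may be taken close enough to `δ` to stay below
`5 √2 √δ |t|`.
-/

noncomputable section

/-! ### Ampliations -/

section Ampliation

variable {ι : Type*} {H K : Type*}

theorem lp.hasSum_norm_sq [NormedAddCommGroup H] (x : lp (fun _ : ι => H) 2) :
    HasSum (fun i => ‖x i‖ ^ 2) (‖x‖ ^ 2) := by
  have h := lp.hasSum_norm (p := 2) (by norm_num) x
  simpa using h

theorem memℓp_two_iff [NormedAddCommGroup H] {f : ι → H} :
    Memℓp f 2 ↔ Summable fun i => ‖f i‖ ^ 2 := by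
  rw [memℓp_gen_iff (by norm_num)]
  simp

variable [NormedAddCommGroup H] [InnerProductSpace ℂ H]
  [NormedAddCommGroup K] [InnerProductSpace ℂ K]

theorem memℓp_two_comp (T : H →L[ℂ] K) (x : lp (fun _ : ι => H) 2) :
    Memℓp (fun i => T (x i)) 2 := by
  rw [memℓp_two_iff]
  refine Summable.of_nonneg_of_le (fun _ => by positivity) (fun i => ?_)
    ((lp.hasSum_norm_sq x).summable.mul_left (‖T‖ ^ 2))
  rw [← mul_pow]
  gcongr
  exact T.le_opNorm _

/-- The operator `T ⊗ 1 : H ⊗ ℓ²(ι) → K ⊗ ℓ²(ι)`, acting coordinatewise on square-summable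
families. -/
def lpMap (ι : Type*) (T : H →L[ℂ] K) :
    lp (fun _ : ι => H) 2 →L[ℂ] lp (fun _ : ι => K) 2 :=
  LinearMap.mkContinuous
    { toFun := fun x => ⟨fun i => T (x i), memℓp_two_comp T x⟩
      map_add' := fun x y => by ext i; exact map_add T (x i) (y i)
      map_smul' := fun c x => by ext i; exact map_smul T c (x i) } ‖T‖ fun x => by
    refine lp.norm_le_of_tsum_le (by norm_num) (by positivity) ?_
    have h := (lp.hasSum_norm_sq x).mul_left (‖T‖ ^ 2)
    simp only [ENNReal.toReal_ofNat, Real.rpow_ofNat, mul_pow]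
    refine (Summable.tsum_le_tsum (fun i => ?_)
      (memℓp_two_iff.1 (memℓp_two_comp T x)) h.summable).trans_eq h.tsum_eq
    rw [← mul_pow]
    exact pow_le_pow_left₀ (norm_nonneg _) (T.le_opNorm _) 2

@[simp]
theorem lpMap_apply (T : H →L[ℂ] K) (x : lp (fun _ : ι => H) 2) (i : ι) :
    lpMap ι T x i = T (x i) := rfl

theorem norm_lpMap_le (T : H →L[ℂ] K) : ‖lpMap ι T‖ ≤ ‖T‖ :=
  LinearMap.mkContinuous_norm_le _ (norm_nonneg _) _

theorem norm_lpMap_apply_le {T : H →L[ℂ] K} {c : ℝ} (hT : ‖T‖ ≤ c)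
    (x : lp (fun _ : ι => H) 2) : ‖lpMap ι T x‖ ≤ c * ‖x‖ :=
  (lpMap ι T).le_of_opNorm_le ((norm_lpMap_le T).trans hT) x

theorem lpMap_single [DecidableEq ι] (T : H →L[ℂ] K) (i : ι) (h : H) :
    lpMap ι T (lp.single 2 i h) = lp.single 2 i (T h) := by
  ext j
  by_cases hij : j = i
  · subst hij; simp
  · simp [hij]

/-- The representation `a ↦ a ⊗ 1` of `B(H)` on `H ⊗ ℓ²(ι)`. -/
def amp (ι H : Type*) [NormedAddCommGroup H] [InnerProductSpace ℂ H] [CompleteSpace H] :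
    (H →L[ℂ] H) →⋆ₐ[ℂ] (lp (fun _ : ι => H) 2 →L[ℂ] lp (fun _ : ι => H) 2) where
  toFun := lpMap ι
  map_one' := by ext; simp
  map_mul' a b := by ext; simp
  map_zero' := by ext; simp
  map_add' a b := by ext; simp
  commutes' c := by ext; simp [Algebra.algebraMap_eq_smul_one]
  map_star' a := by
    rw [ContinuousLinearMap.star_eq_adjoint, ContinuousLinearMap.star_eq_adjoint,
      ContinuousLinearMap.eq_adjoint_iff]
    intro x y
    simp only [lp.inner_eq_tsum, lpMap_apply, ContinuousLinearMap.adjoint_inner_left]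

@[simp]
theorem amp_apply [CompleteSpace H] (a : H →L[ℂ] H) (x : lp (fun _ : ι => H) 2) (i : ι) :
    amp ι H a x i = a (x i) := rfl

end Ampliation

/-! ### Monotone nets of operators and normality of ampliations -/

section Normal

open scoped ComplexOrder InnerProductSpace
open Filter Topology

variable {H L : Type*}
  [NormedAddCommGroup H] [InnerProductSpace ℂ H]
  [NormedAddCommGroup L] [InnerProductSpace ℂ L]

theorem ContinuousLinearMap.le_iff_forall_inner_le {a b : H →L[ℂ] H} :
    a ≤ b ↔ ∀ x, ⟪a x, x⟫_ℂ ≤ ⟪b x, x⟫_ℂ := by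
  rw [ContinuousLinearMap.le_def, ContinuousLinearMap.isPositive_iff_complex]
  refine forall_congr' fun x => ?_
  rw [sub_apply, inner_sub_left, ← sub_nonneg (b := ⟪a x, x⟫_ℂ),
    Complex.nonneg_iff]
  simp [Complex.ext_iff, and_comm, eq_comm]

variable [CompleteSpace H] [CompleteSpace L]

/-- A net of operators which is uniformly bounded has, along any ultrafilter, a limit in the weak
operator topology. -/
theorem exists_weak_limit_of_bounded {α : Type*} (F : Ultrafilter α) (s : α → H →L[ℂ] H) (C : ℝ)
    (hC : ∀ᶠ i in F, ‖s i‖ ≤ C) :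
    ∃ a : H →L[ℂ] H, ∀ x y, Tendsto (fun i => ⟪s i x, y⟫_ℂ) F (𝓝 ⟪a x, y⟫_ℂ) := by
  have hb (x y : H) : ∀ᶠ i in F, ⟪s i x, y⟫_ℂ ∈ Metric.closedBall (0 : ℂ) (C * ‖x‖ * ‖y‖) := by
    filter_upwards [hC] with i hi
    rw [mem_closedBall_zero_iff]
    refine (norm_inner_le_norm _ _).trans ?_
    gcongr
    exact (s i).le_of_opNorm_le hi x
  have hlim (x y : H) : ∃ b : ℂ, ‖b‖ ≤ C * ‖x‖ * ‖y‖ ∧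
      Tendsto (fun i => ⟪s i x, y⟫_ℂ) F (𝓝 b) := by
    obtain ⟨b, hb1, hb2⟩ := (isCompact_closedBall (0 : ℂ) (C * ‖x‖ * ‖y‖)).ultrafilter_le_nhds
      (F.map fun i => ⟪s i x, y⟫_ℂ) (by rw [le_principal_iff]; exact hb x y)
    exact ⟨b, by simpa using hb1, hb2⟩
  choose B hB hBt using hlim
  let B' : H →ₗ⋆[ℂ] H →ₗ[ℂ] ℂ := LinearMap.mk₂'ₛₗ (starRingEnd ℂ) (RingHom.id ℂ) B
    (fun x x' y => tendsto_nhds_unique (hBt _ _) <| by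
      simpa [inner_add_left] using (hBt x y).add (hBt x' y))
    (fun c x y => tendsto_nhds_unique (hBt _ _) <| by
      simpa [inner_smul_left, mul_comm] using (hBt x y).const_mul (starRingEnd ℂ c))
    (fun x y y' => tendsto_nhds_unique (hBt _ _) <| by
      simpa [inner_add_right] using (hBt x y).add (hBt x y'))
    (fun c x y => tendsto_nhds_unique (hBt _ _) <| by
      simpa [inner_smul_right] using (hBt x y).const_mul c)
  refine ⟨InnerProductSpace.continuousLinearMapOfBilin (B'.mkContinuous₂ C hB), fun x y => ?_⟩
  rw [InnerProductSpace.continuousLinearMapOfBilin_apply]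
  exact hBt x y

/-- An increasing net of selfadjoint operators converges weakly to its supremum. -/
theorem tendsto_inner_of_isLUB {S : Set (H →L[ℂ] H)} {a : H →L[ℂ] H}
    (hne : S.Nonempty) (hdir : DirectedOn (· ≤ ·) S)
    (ha : IsLUB S a) (x : H) :
    Tendsto (fun s : S => (⟪(s : H →L[ℂ] H) x, x⟫_ℂ).re) atTop (𝓝 (⟪a x, x⟫_ℂ).re) := by
  have hS : Nonempty S := hne.to_subtype
  have : IsDirectedOrder S := directedOn_iff_isDirectedOrder.1 hdir
  have s₀ : S := hS.some
  let F : Ultrafilter S := Ultrafilter.of atTop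
  have hF : (F : Filter S) ≤ atTop := Ultrafilter.of_le _
  have hle (s : S) : (s : H →L[ℂ] H) ≤ a := ha.1 s.2
  have hbd : ∀ᶠ s : S in (F : Filter S), ‖(s : H →L[ℂ] H)‖ ≤ ‖a‖ + ‖a - s₀‖ := by
    filter_upwards [hF (eventually_ge_atTop s₀)] with s hs
    have h1 : ‖a - s‖ ≤ ‖a - s₀‖ :=
      CStarAlgebra.norm_le_norm_of_nonneg_of_le (sub_nonneg.2 (hle s))
        (sub_le_sub_left (show (s₀ : H →L[ℂ] H) ≤ s from hs) a)
    calc ‖(s : H →L[ℂ] H)‖ = ‖a - (a - s)‖ := by rw [sub_sub_cancel]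
      _ ≤ ‖a‖ + ‖a - s‖ := norm_sub_le _ _
      _ ≤ _ := by gcongr
  obtain ⟨a', ha'⟩ := exists_weak_limit_of_bounded F (fun s : S => (s : H →L[ℂ] H)) _ hbd
  have haa' : a = a' := by
    refine le_antisymm (ha.2 fun s hs => ?_) ?_
    · rw [ContinuousLinearMap.le_iff_forall_inner_le]
      refine fun y => ge_of_tendsto (ha' y y) ?_
      filter_upwards [hF (eventually_ge_atTop ⟨s, hs⟩)] with t ht
      exact ContinuousLinearMap.le_iff_forall_inner_le.1 ht y
    · rw [ContinuousLinearMap.le_iff_forall_inner_le]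
      exact fun y => le_of_tendsto' (ha' y y) fun t =>
        ContinuousLinearMap.le_iff_forall_inner_le.1 (hle t) y
  have hmono : Monotone fun s : S => (⟪(s : H →L[ℂ] H) x, x⟫_ℂ).re := fun s t hst =>
    (Complex.le_def.1 (ContinuousLinearMap.le_iff_forall_inner_le.1 hst x)).1
  have hbdd : BddAbove (Set.range fun s : S => (⟪(s : H →L[ℂ] H) x, x⟫_ℂ).re) :=
    ⟨(⟪a x, x⟫_ℂ).re, by
      rintro _ ⟨s, rfl⟩
      exact (Complex.le_def.1 (ContinuousLinearMap.le_iff_forall_inner_le.1 (hle s) x)).1⟩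
  have hsup := tendsto_atTop_ciSup hmono hbdd
  have hlim : Tendsto (fun s : S => (⟪(s : H →L[ℂ] H) x, x⟫_ℂ).re) F (𝓝 (⟪a x, x⟫_ℂ).re) := by
    rw [haa']
    exact (Complex.continuous_re.tendsto _).comp (ha' x x)
  rwa [tendsto_nhds_unique hlim (hsup.mono_left hF)]

/-- A representation which is unitarily equivalent to an ampliation is normal. The sums
`∑ ⟪s xᵢ, xᵢ⟫` converge to `∑ ⟪a xᵢ, xᵢ⟫` along the net by dominated convergence. -/
theorem isNormalRep_of_lp {ι : Type*} (π : (H →L[ℂ] H) →⋆ₐ[ℂ] (L →L[ℂ] L))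
    (W : L ≃ₗᵢ[ℂ] lp (fun _ : ι => H) 2)
    (hW : ∀ (a : H →L[ℂ] H) (x : L) (i : ι), W (π a x) i = a (W x i)) : IsNormalRep π := by
  have hinner (a : H →L[ℂ] H) (x : L) :
      HasSum (fun i => ⟪a (W x i), W x i⟫_ℂ) ⟪π a x, x⟫_ℂ := by
    have h := lp.hasSum_inner (𝕜 := ℂ) (W (π a x)) (W x)
    rw [W.inner_map_map] at h
    simpa only [hW] using h
  have hmono {a b : H →L[ℂ] H} (hab : a ≤ b) : π a ≤ π b := by
    rw [ContinuousLinearMap.le_iff_forall_inner_le] at hab ⊢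
    exact fun x => hasSum_le (fun i => hab _) (hinner a x) (hinner b x)
  intro S a _ hne hdir ha
  refine ⟨by rintro _ ⟨s, hs, rfl⟩; exact hmono (ha.1 hs), fun b hb => ?_⟩
  have hS : Nonempty S := hne.to_subtype
  have : IsDirectedOrder S := directedOn_iff_isDirectedOrder.1 hdir
  have s₀ : S := hS.some
  rw [ContinuousLinearMap.le_iff_forall_inner_le]
  intro x
  have hre (c : H →L[ℂ] H) (y : H) :
      (⟪(a - c) y, y⟫_ℂ).re = (⟪a y, y⟫_ℂ).re - (⟪c y, y⟫_ℂ).re := by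
    rw [sub_apply, inner_sub_left, Complex.sub_re]
  have hres (c : H →L[ℂ] H) : HasSum (fun i => (⟪(a - c) (W x i), W x i⟫_ℂ).re)
      (⟪π (a - c) x, x⟫_ℂ).re := Complex.hasSum_re (hinner (a - c) x)
  have hlim : Tendsto (fun s : S => ∑' i, (⟪(a - (s : H →L[ℂ] H)) (W x i), W x i⟫_ℂ).re) atTop
      (𝓝 (∑' _ : ι, (0 : ℝ))) := by
    refine tendsto_tsum_of_dominated_convergence (hres s₀).summable (fun i => ?_) ?_
    · have h := (tendsto_inner_of_isLUB hne hdir ha (W x i)).const_sub (⟪a (W x i), W x i⟫_ℂ).re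
      simpa only [hre, sub_self] using h
    · filter_upwards [eventually_ge_atTop s₀] with s hs i
      have h1 := (Complex.le_def.1
        (ContinuousLinearMap.le_iff_forall_inner_le.1 (ha.1 s.2) (W x i))).1
      have h2 := (Complex.le_def.1
        (ContinuousLinearMap.le_iff_forall_inner_le.1 (show (s₀ : H →L[ℂ] H) ≤ s from hs)
          (W x i))).1
      rw [hre, hre, Real.norm_of_nonneg (sub_nonneg.2 h1)]
      linarith
  have hlim' : Tendsto (fun s : S => (⟪π (s : H →L[ℂ] H) x, x⟫_ℂ).re) atTop
      (𝓝 (⟪π a x, x⟫_ℂ).re) := by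
    simp only [(hres _).tsum_eq, tsum_zero] at hlim
    have h := hlim.const_sub (⟪π a x, x⟫_ℂ).re
    simpa [inner_sub_left] using h
  have hbx (s : S) := Complex.le_def.1
    (ContinuousLinearMap.le_iff_forall_inner_le.1 (hb ⟨s, s.2, rfl⟩) x)
  have hax := Complex.le_def.1
    (ContinuousLinearMap.le_iff_forall_inner_le.1 (hmono (ha.1 s₀.2)) x)
  exact Complex.le_def.2 ⟨le_of_tendsto' hlim' fun s => (hbx s).1, hax.2.symm.trans (hbx s₀).2⟩

end Normal

/-! ### Normal representations of `B(H)` are multiples of the identity representation -/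

section Structure

open scoped ComplexOrder InnerProductSpace
open Filter Topology InnerProductSpace

variable {H L : Type*}
  [NormedAddCommGroup H] [InnerProductSpace ℂ H]
  [NormedAddCommGroup L] [InnerProductSpace ℂ L]

theorem hasSum_inner_rankOne {κ : Type*} (b : HilbertBasis κ ℂ H) (x : H) :
    HasSum (fun j => ⟪rankOne ℂ (b j) (b j) x, x⟫_ℂ) ⟪x, x⟫_ℂ := by
  have h := b.hasSum_inner_mul_inner x x
  simpa only [rankOne_apply, inner_smul_left, inner_conj_symm] using h

theorem inner_rankOne_self_nonneg (e x : H) : 0 ≤ ⟪rankOne ℂ e e x, x⟫_ℂ :=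
  ((InnerProductSpace.isPositive_rankOne_self (𝕜 := ℂ) e)).inner_nonneg_left x

theorem sum_rankOne_le_one {κ : Type*} (b : HilbertBasis κ ℂ H) (s : Finset κ) :
    ∑ j ∈ s, rankOne ℂ (b j) (b j) ≤ 1 := by
  rw [ContinuousLinearMap.le_iff_forall_inner_le]
  intro x
  rw [sum_apply, sum_inner, one_apply_eq_self]
  exact sum_le_hasSum s (fun j _ => inner_rankOne_self_nonneg _ _) (hasSum_inner_rankOne b x)

/-- The identity is the supremum of the finite partial sums of the rank-one projections belonging
to a Hilbert basis. -/
theorem isLUB_sum_rankOne {κ : Type*} (b : HilbertBasis κ ℂ H) :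
    IsLUB (Set.range fun s : Finset κ => ∑ j ∈ s, rankOne ℂ (b j) (b j)) 1 := by
  refine ⟨by rintro _ ⟨s, rfl⟩; exact sum_rankOne_le_one b s, fun c hc => ?_⟩
  rw [ContinuousLinearMap.le_iff_forall_inner_le]
  intro x
  refine le_of_tendsto' (hasSum_inner_rankOne b x) fun s => ?_
  have h := ContinuousLinearMap.le_iff_forall_inner_le.1 (hc ⟨s, rfl⟩) x
  rwa [sum_apply, sum_inner] at h

variable [CompleteSpace H] [CompleteSpace L]

/-- If a normal representation maps all rank-one projections into a closed subspace, then this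
subspace is everything. -/
theorem IsNormalRep.eq_top_of_rankOne_mem {π : (H →L[ℂ] H) →⋆ₐ[ℂ] (L →L[ℂ] L)}
    (hπ : IsNormalRep π) (R : Submodule ℂ L) [R.HasOrthogonalProjection]
    (hR : ∀ (h : H) (y : L), π (rankOne ℂ h h) y ∈ R) : R = ⊤ := by
  obtain ⟨κ, b, -⟩ := exists_hilbertBasis ℂ H
  have hpos (s : Finset κ) : 0 ≤ ∑ j ∈ s, rankOne ℂ (b j) (b j) :=
    Finset.sum_nonneg fun j _ => (ContinuousLinearMap.nonneg_iff_isPositive _).2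
      (InnerProductSpace.isPositive_rankOne_self _)
  have hlub := hπ _ _ (by
      rintro _ ⟨s, rfl⟩
      exact .of_nonneg (hpos s)) (Set.range_nonempty _) (by
      refine directedOn_range.2 (Monotone.directed_le ?_)
      exact Finset.sum_mono_set_of_nonneg fun j => (ContinuousLinearMap.nonneg_iff_isPositive _).2
        (InnerProductSpace.isPositive_rankOne_self _)) (isLUB_sum_rankOne b)
  have hQ : (1 : L →L[ℂ] L) ≤ R.starProjection := by
    rw [← map_one π]
    refine hlub.2 ?_
    rintro _ ⟨_, ⟨s, rfl⟩, rfl⟩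
    set P := π (∑ j ∈ s, rankOne ℂ (b j) (b j)) with hP
    have hQsa : star R.starProjection = R.starProjection :=
      (isStarProjection_starProjection (U := R)).isSelfAdjoint
    have hPsa : star P = P := ((IsSelfAdjoint.of_nonneg (hpos s)).map π)
    have hQP : R.starProjection * P = P := by
      ext y
      rw [mul_apply_eq_comp, Submodule.starProjection_eq_self_iff, hP, map_sum,
        sum_apply]
      exact Submodule.sum_mem _ fun j _ => hR _ _
    have hPQ : P * R.starProjection = P := by
      simpa [hPsa, hQsa] using congrArg star hQP
    have hP1 : P ≤ 1 := by
      rw [← map_one π]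
      exact OrderHomClass.mono π (sum_rankOne_le_one b s)
    have h := star_left_conjugate_le_conjugate hP1 R.starProjection
    rwa [hQsa, hQP, hPQ, mul_one,
      (isStarProjection_starProjection (U := R)).isIdempotentElem.eq] at h
  rw [eq_top_iff, ← Submodule.starProjection_le_starProjection_iff, Submodule.starProjection_top]
  exact hQ

/-- A normal representation `π` of `B(H)` on `L` is a multiple of the identity representation:
`L` is the Hilbert sum of isometric copies `V i : H → L` of `H` which intertwine `π` with the
identity representation. With a unit vector `e` and a Hilbert basis `f` of the range of the
projection `π (|e⟩⟨e|)`, one takes `V i h = π (|h⟩⟨e|) (f i)`. -/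
theorem IsNormalRep.exists_isHilbertSum.{u, v} {H : Type u} {L : Type v} [NormedAddCommGroup H]
    [InnerProductSpace ℂ H] [CompleteSpace H]
    [NormedAddCommGroup L] [InnerProductSpace ℂ L] [CompleteSpace L]
    {π : (H →L[ℂ] H) →⋆ₐ[ℂ] (L →L[ℂ] L)} (hπ : IsNormalRep π) (e : H) (he : ‖e‖ = 1) :
    ∃ (ι : Type v) (V : ι → H →ₗᵢ[ℂ] L), IsHilbertSum ℂ (fun _ => H) V ∧
      ∀ (a : H →L[ℂ] H) (i : ι) (h : H), π a (V i h) = V i (a h) := by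
  have hmul (x y z w : H) (l : L) : π (rankOne ℂ x y) (π (rankOne ℂ z w) l) =
      ⟪y, z⟫_ℂ • π (rankOne ℂ x w) l := by
    rw [← mul_apply_eq_comp, ← map_mul, ContinuousLinearMap.mul_def,
      rankOne_comp_rankOne, map_smul, smul_apply]
  have hee : ⟪e, e⟫_ℂ = 1 := by simp [inner_self_eq_norm_sq_to_K, he]
  let F : Submodule ℂ L := LinearMap.ker (π (rankOne ℂ e e) - 1 : L →L[ℂ] L).toLinearMap
  have hF (f : L) : f ∈ F ↔ π (rankOne ℂ e e) f = f := by
    simp [F, sub_eq_zero]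
  have hFc : IsClosed (F : Set L) := ContinuousLinearMap.isClosed_ker _
  have : CompleteSpace F := hFc.completeSpace_coe
  have hinner (f g : L) (hg : g ∈ F) (h h' : H) :
      ⟪π (rankOne ℂ h e) f, π (rankOne ℂ h' e) g⟫_ℂ = ⟪h, h'⟫_ℂ * ⟪f, g⟫_ℂ := by
    rw [← ContinuousLinearMap.adjoint_inner_right, ← ContinuousLinearMap.star_eq_adjoint,
      ← map_star, ContinuousLinearMap.star_eq_adjoint, adjoint_rankOne, hmul, (hF g).1 hg,
      inner_smul_right]
  obtain ⟨w, b, -⟩ := exists_hilbertBasis ℂ F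
  have hb (i : w) : ⟪(b i : L), b i⟫_ℂ = 1 := by
    rw [inner_self_eq_norm_sq_to_K, Submodule.norm_coe, b.orthonormal.1 i]
    simp
  let V (i : w) : H →ₗᵢ[ℂ] L := LinearMap.isometryOfInner
    { toFun := fun h => π (rankOne ℂ h e) (b i)
      map_add' := fun h h' => by simp
      map_smul' := fun c h => by simp } fun h h' => by
        simp only [LinearMap.coe_mk, AddHom.coe_mk]
        rw [hinner _ _ (b i).2, hb, mul_one]
  have hV (i : w) (h : H) : V i h = π (rankOne ℂ h e) (b i) := rfl
  have horth : OrthogonalFamily ℂ (fun _ : w => H) V := fun i j hij h h' => by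
    rw [hV, hV, hinner _ _ (b j).2, ← Submodule.coe_inner, b.orthonormal.2 hij, mul_zero]
  let R : Submodule ℂ L := (⨆ i, LinearMap.range (V i).toLinearMap).topologicalClosure
  have : CompleteSpace R := (Submodule.isClosed_topologicalClosure _).completeSpace_coe
  have hR : R = ⊤ := by
    refine hπ.eq_top_of_rankOne_mem R fun h y => ?_
    -- `|h⟩⟨h| = |h⟩⟨e| |e⟩⟨h|`, and the second factor takes its values in `F`
    have hyF : π (rankOne ℂ e h) y ∈ F := by rw [hF, hmul, hee, one_smul]
    have hy : π (rankOne ℂ h h) y = π (rankOne ℂ h e) (π (rankOne ℂ e h) y) := by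
      rw [hmul, hee, one_smul]
    rw [hy]
    generalize π (rankOne ℂ e h) y = f at hyF
    have hsum := (((b.hasSum_repr ⟨f, hyF⟩).mapL F.subtypeL)).mapL (π (rankOne ℂ h e))
    refine (Submodule.isClosed_topologicalClosure _).mem_of_tendsto hsum
      (Eventually.of_forall fun s => ?_)
    refine Submodule.sum_mem _ fun i _ => Submodule.le_topologicalClosure _ ?_
    simp only [map_smul]
    refine Submodule.smul_mem _ _ (Submodule.mem_iSup_of_mem i ⟨h, rfl⟩)
  refine ⟨w, V, IsHilbertSum.mk horth hR.ge, fun a i h => ?_⟩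
  rw [hV, hV, ← mul_apply_eq_comp, ← map_mul, ContinuousLinearMap.mul_def, comp_rankOne]

end Structure

/-! ### Equivalent tuples become unitarily equivalent after countable ampliation -/

section Countable

open scoped InnerProductSpace
open Filter Topology

/-- Two countable index sets closed under given countable neighbourhood relations, one of them
containing a given index. -/
theorem exists_countable_closed {ι κ : Type*} (N : ι → Set κ) (N' : κ → Set ι)
    (hN : ∀ i, (N i).Countable) (hN' : ∀ j, (N' j).Countable) (i₀ : ι) :
    ∃ (S : Set ι) (S' : Set κ), S.Countable ∧ S'.Countable ∧ i₀ ∈ S ∧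
      (∀ i ∈ S, N i ⊆ S') ∧ ∀ j ∈ S', N' j ⊆ S := by
  let f : Set ι → Set ι := fun A => ⋃ i ∈ A, ⋃ j ∈ N i, N' j
  have hf (n : ℕ) : (f^[n] {i₀}).Countable := by
    induction n with
    | zero => exact Set.countable_singleton _
    | succ n ih =>
      rw [Function.iterate_succ_apply']
      exact ih.biUnion fun i _ => (hN i).biUnion fun j _ => hN' j
  have hS : (⋃ n, f^[n] {i₀}).Countable := Set.countable_iUnion hf
  refine ⟨⋃ n, f^[n] {i₀}, ⋃ i ∈ ⋃ n, f^[n] {i₀}, N i, hS, hS.biUnion fun i _ => hN i,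
    Set.mem_iUnion.2 ⟨0, rfl⟩, fun i hi => Set.subset_biUnion_of_mem (u := N) hi,
    fun j hj i hi => ?_⟩
  simp only [Set.mem_iUnion] at hj
  obtain ⟨i', ⟨n, hi'⟩, hj⟩ := hj
  refine Set.mem_iUnion.2 ⟨n + 1, ?_⟩
  rw [Function.iterate_succ_apply']
  exact Set.mem_biUnion hi' (Set.mem_biUnion hj hi)

variable {ι κ : Type*} {H K L : Type*}
  [NormedAddCommGroup H] [InnerProductSpace ℂ H]
  [NormedAddCommGroup K] [InnerProductSpace ℂ K]
  [NormedAddCommGroup L] [InnerProductSpace ℂ L]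

theorem countable_support_lp {H : Type*} [NormedAddCommGroup H]
    (x : lp (fun _ : ι => H) 2) : {i | x i ≠ 0}.Countable := by
  refine (lp.hasSum_norm_sq x).summable.countable_support.mono fun i hi => ?_
  simpa using hi

/-- The vectors of a separable subspace of a Hilbert sum involve only countably many summands. -/
theorem IsHilbertSum.countable_support_isometry [CompleteSpace L]
    [TopologicalSpace.SeparableSpace H]
    {W : κ → K →ₗᵢ[ℂ] L} (hW : IsHilbertSum ℂ (fun _ => K) W) (A : H →ₗᵢ[ℂ] L) :
    {j | ∃ h, hW.linearIsometryEquiv (A h) j ≠ 0}.Countable := by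
  refine (Set.countable_iUnion fun n => countable_support_lp
    (hW.linearIsometryEquiv (A (TopologicalSpace.denseSeq H n)))).mono fun j hj => ?_
  by_contra hcon
  simp only [Set.mem_iUnion, Set.mem_ofPred_eq, not_exists, not_not] at hcon
  obtain ⟨h, hh⟩ := hj
  have hcont : Continuous fun h : H => hW.linearIsometryEquiv (A h) j :=
    ((lp.evalCLM ℂ (fun _ : κ => K) 2 j).continuous.comp
      hW.linearIsometryEquiv.continuous).comp A.continuous
  refine hh (congrFun (hcont.ext_on (TopologicalSpace.denseRange_denseSeq H)
    (continuous_const (y := (0 : K))) ?_) h)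
  rintro _ ⟨n, rfl⟩
  exact hcon n

/-- A vector of a Hilbert sum lies in the closed span of the summands that it involves. -/
theorem IsHilbertSum.mem_closure_of_support [CompleteSpace L]
    {W : κ → K →ₗᵢ[ℂ] L} (hW : IsHilbertSum ℂ (fun _ => K) W) {x : L} {S : Set κ}
    (hx : {j | hW.linearIsometryEquiv x j ≠ 0} ⊆ S) :
    x ∈ (⨆ j : S, LinearMap.range (W j).toLinearMap).topologicalClosure := by
  have h := hW.hasSum_linearIsometryEquiv_symm (hW.linearIsometryEquiv x)
  rw [LinearIsometryEquiv.symm_apply_apply] at h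
  refine (Submodule.isClosed_topologicalClosure _).mem_of_tendsto h
    (Eventually.of_forall fun s => Submodule.sum_mem _ fun j _ => ?_)
  by_cases hj : hW.linearIsometryEquiv x j = 0
  · simp [hj]
  · exact Submodule.le_topologicalClosure _
      (Submodule.mem_iSup_of_mem (⟨j, hx hj⟩ : S) ⟨_, rfl⟩)

/-- If a Hilbert space is a multiple both of the separable space `H` and of the separable space
`K`, then it has a closed subspace which is the sum of countably many of the copies of `H` and also
of countably many of the copies of `K`. -/
theorem IsHilbertSum.exists_countable_closure_eq [CompleteSpace L]
    [TopologicalSpace.SeparableSpace H] [TopologicalSpace.SeparableSpace K]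
    {V : ι → H →ₗᵢ[ℂ] L} {W : κ → K →ₗᵢ[ℂ] L} (hV : IsHilbertSum ℂ (fun _ => H) V)
    (hW : IsHilbertSum ℂ (fun _ => K) W) (i₀ : ι) :
    ∃ (S : Set ι) (S' : Set κ), S.Countable ∧ S'.Countable ∧ i₀ ∈ S ∧
      (⨆ i : S, LinearMap.range (V i).toLinearMap).topologicalClosure =
        (⨆ j : S', LinearMap.range (W j).toLinearMap).topologicalClosure := by
  obtain ⟨S, S', hS, hS', hi₀, h1, h2⟩ := exists_countable_closed
    (fun i => {j | ∃ h, hW.linearIsometryEquiv (V i h) j ≠ 0})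
    (fun j => {i | ∃ k, hV.linearIsometryEquiv (W j k) i ≠ 0})
    (fun i => hW.countable_support_isometry (V i))
    (fun j => hV.countable_support_isometry (W j)) i₀
  refine ⟨S, S', hS, hS', hi₀, le_antisymm ?_ ?_⟩
  · refine Submodule.topologicalClosure_minimal _ (iSup_le fun i => ?_)
      (Submodule.isClosed_topologicalClosure _)
    rintro _ ⟨h, rfl⟩
    exact hW.mem_closure_of_support fun j hj => h1 i i.2 ⟨h, hj⟩
  · refine Submodule.topologicalClosure_minimal _ (iSup_le fun i => ?_)
      (Submodule.isClosed_topologicalClosure _)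
    rintro _ ⟨h, rfl⟩
    exact hV.mem_closure_of_support fun j hj => h2 i i.2 ⟨h, hj⟩

/-- The inclusion of the `i`-th copy of `H` in `ℓ²(ι, H)`, as a linear isometry. -/
def lpSingle [DecidableEq ι] (H : Type*) [NormedAddCommGroup H] [InnerProductSpace ℂ H] (i : ι) :
    H →ₗᵢ[ℂ] lp (fun _ : ι => H) 2 where
  toFun x := lp.single (E := fun _ : ι => H) 2 i x
  map_add' x y := lp.single_add (E := fun _ : ι => H) 2 i x y
  map_smul' c x := lp.single_smul (𝕜 := ℂ) (E := fun _ : ι => H) 2 i c x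
  norm_map' x := lp.norm_single (p := 2) (E := fun _ : ι => H) two_pos i x

@[simp]
theorem lpSingle_apply [DecidableEq ι] (i : ι) (x : H) :
    lpSingle H i x = lp.single (E := fun _ : ι => H) 2 i x := rfl

/-- A sequence of mutually orthogonal copies of `H` in `L` gives rise to an embedding of `ℓ²(ℕ, H)`
in `ℓ²(ℕ, L)`, whose range consists of the sequences in the closed span of these copies. -/
theorem OrthogonalFamily.exists_ampliation [CompleteSpace H] [CompleteSpace L] [Countable ι]
    [Nonempty ι] {V : ι → H →ₗᵢ[ℂ] L} (hV : OrthogonalFamily ℂ (fun _ => H) V) :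
    ∃ F : lp (fun _ : ℕ => H) 2 →ₗᵢ[ℂ] lp (fun _ : ℕ => L) 2,
      (∀ y, y ∈ LinearMap.range F.toLinearMap ↔ ∀ n,
        y n ∈ (⨆ i, LinearMap.range (V i).toLinearMap).topologicalClosure) ∧
      ∀ (a : H →L[ℂ] H) (A : L →L[ℂ] L), (∀ i h, A (V i h) = V i (a h)) →
        ∀ x, amp ℕ L A (F x) = F (amp ℕ H a x) := by
  obtain ⟨e⟩ : Nonempty (ℕ ≃ ℕ × ι) := nonempty_equiv_of_countable
  set R := (⨆ i, LinearMap.range (V i).toLinearMap).topologicalClosure with hR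
  have hRc : IsClosed (R : Set L) := Submodule.isClosed_topologicalClosure _
  let V' (m : ℕ) : H →ₗᵢ[ℂ] lp (fun _ : ℕ => L) 2 := (lpSingle L (e m).1).comp (V (e m).2)
  have hV'a (m : ℕ) (h : H) : V' m h = lp.single 2 (e m).1 (V (e m).2 h) := rfl
  have hV' : OrthogonalFamily ℂ (fun _ => H) V' := fun m m' hm h h' => by
    rw [hV'a, hV'a, lp.inner_single_left]
    by_cases h1 : (e m).1 = (e m').1
    · rw [h1, lp.single_apply_self]
      exact hV (fun h2 => hm (e.injective (Prod.ext h1 h2))) _ _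
    · rw [lp.single_apply_ne _ _ _ h1, inner_zero_right]
  refine ⟨hV'.linearIsometry, fun y => ⟨?_, fun hy => ?_⟩, fun a A hA x => ?_⟩
  · rintro ⟨x, rfl⟩ n
    have h := (hV'.hasSum_linearIsometry x).mapL (lp.evalCLM ℂ (fun _ : ℕ => L) 2 n)
    refine hRc.mem_of_tendsto h (Eventually.of_forall fun s => Submodule.sum_mem _ fun m _ => ?_)
    change (V' m (x m) : ∀ _, L) n ∈ R
    rw [hV'a]
    by_cases h1 : n = (e m).1
    · rw [h1, lp.single_apply_self]
      exact Submodule.le_topologicalClosure _ (Submodule.mem_iSup_of_mem _ ⟨_, rfl⟩)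
    · rw [lp.single_apply_ne _ _ _ h1]
      exact R.zero_mem
  · have hcl : IsClosed
        (LinearMap.range hV'.linearIsometry.toLinearMap : Set (lp (fun _ : ℕ => L) 2)) :=
      hV'.linearIsometry.isometry.isUniformInducing.isComplete_range.isClosed
    refine hcl.mem_of_tendsto (lp.hasSum_single (by norm_num) y)
      (Eventually.of_forall fun s => Submodule.sum_mem _ fun n _ => ?_)
    have hle : R ≤ (LinearMap.range hV'.linearIsometry.toLinearMap).comap
        (lpSingle L n).toLinearMap := by
      refine Submodule.topologicalClosure_minimal _ (iSup_le fun i => ?_)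
        (hcl.preimage (lpSingle L n).continuous)
      rintro _ ⟨h, rfl⟩
      refine ⟨lp.single 2 (e.symm (n, i)) h, ?_⟩
      simp [hV'a]
    exact hle (hy n)
  · have h1 := (hV'.hasSum_linearIsometry x).mapL (amp ℕ L A)
    have h2 := hV'.hasSum_linearIsometry (amp ℕ H a x)
    refine h1.unique ?_
    convert h2 using 2 with m
    rw [hV'a, hV'a, amp_apply, ← hA]
    exact lpMap_single A _ _

end Countable

section TupleEquiv

variable {H K : Type*}
  [NormedAddCommGroup H] [InnerProductSpace ℂ H] [CompleteSpace H]
  [NormedAddCommGroup K] [InnerProductSpace ℂ K] [CompleteSpace K]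

theorem subsingleton_of_starAlgHom {L : Type*} [NormedAddCommGroup L] [InnerProductSpace ℂ L]
    [CompleteSpace L] [Subsingleton L] (π : (H →L[ℂ] H) →⋆ₐ[ℂ] (L →L[ℂ] L))
    (hπ : Function.Injective π) : Subsingleton H := by
  refine subsingleton_of_forall_eq 0 fun x => ?_
  have h : (1 : H →L[ℂ] H) = 0 := hπ (ContinuousLinearMap.ext fun _ => Subsingleton.elim _ _)
  exact congrArg (fun a : H →L[ℂ] H => a x) h

theorem nontrivial_of_starAlgHom {L : Type*} [NormedAddCommGroup L] [InnerProductSpace ℂ L]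
    [CompleteSpace L] [Nontrivial L] (π : (H →L[ℂ] H) →⋆ₐ[ℂ] (L →L[ℂ] L)) : Nontrivial H := by
  by_contra hH
  rw [not_nontrivial_iff_subsingleton] at hH
  have h : (1 : L →L[ℂ] L) = 0 := by
    rw [← map_one π, Subsingleton.elim (1 : H →L[ℂ] H) 0, map_zero]
  exact one_ne_zero h

theorem IsHilbertSum.nonempty_index {ι H L : Type*} [NormedAddCommGroup H]
    [InnerProductSpace ℂ H] [NormedAddCommGroup L]
    [InnerProductSpace ℂ L] [CompleteSpace L] [Nontrivial L] {V : ι → H →ₗᵢ[ℂ] L}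
    (hV : IsHilbertSum ℂ (fun _ => H) V) : Nonempty ι := by
  by_contra hι
  rw [not_nonempty_iff] at hι
  obtain ⟨x, hx⟩ := exists_ne (0 : L)
  exact hx (hV.linearIsometryEquiv.injective (by ext i; exact hι.elim i))

/-- Equivalent tuples on separable spaces become unitarily equivalent when both are tensored with
the identity of `ℓ²(ℕ)`. -/
theorem TupleEquiv.exists_unitary [TopologicalSpace.SeparableSpace H]
    [TopologicalSpace.SeparableSpace K] {d : ℕ} {u : Fin d → OneParamUnitaryGroup H}
    {v : Fin d → OneParamUnitaryGroup K} (h : TupleEquiv u v) :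
    ∃ T : lp (fun _ : ℕ => H) 2 ≃ₗᵢ[ℂ] lp (fun _ : ℕ => K) 2, ∀ k t x,
      T (amp ℕ H ((u k).op t) x) = amp ℕ K ((v k).op t) (T x) := by
  obtain ⟨L, _, _, _, π, ρ, hπ, hρ, huv⟩ := h
  rcases subsingleton_or_nontrivial L with hL | hL
  · have := subsingleton_of_starAlgHom π hπ.1
    have := subsingleton_of_starAlgHom ρ hρ.1
    have : Subsingleton (lp (fun _ : ℕ => H) 2) := ⟨fun x y => by ext; exact Subsingleton.elim _ _⟩
    have : Subsingleton (lp (fun _ : ℕ => K) 2) := ⟨fun x y => by ext; exact Subsingleton.elim _ _⟩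
    exact ⟨⟨0, fun x => by simp [Subsingleton.elim x 0]⟩, fun k t x => Subsingleton.elim _ _⟩
  · have := nontrivial_of_starAlgHom π
    have := nontrivial_of_starAlgHom ρ
    obtain ⟨e, he⟩ := exists_norm_eq H zero_le_one
    obtain ⟨f, hf⟩ := exists_norm_eq K zero_le_one
    obtain ⟨ι, V, hV, hVπ⟩ := hπ.2.exists_isHilbertSum e he
    obtain ⟨κ, W, hW, hWρ⟩ := hρ.2.exists_isHilbertSum f hf
    obtain ⟨i₀⟩ := hV.nonempty_index
    obtain ⟨S, S', hS, hS', hi₀, hSS⟩ := hV.exists_countable_closure_eq hW i₀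
    have : Countable S := hS
    have : Countable S' := hS'
    have : Nonempty S := ⟨i₀, hi₀⟩
    have : Nonempty S' := by
      by_contra hempty
      rw [not_nonempty_iff] at hempty
      have hmem : V i₀ e ∈ (⨆ i : S, LinearMap.range (V i).toLinearMap).topologicalClosure :=
        Submodule.le_topologicalClosure _ (Submodule.mem_iSup_of_mem (⟨i₀, hi₀⟩ : S) ⟨e, rfl⟩)
      rw [hSS, iSup_of_empty, (isClosed_singleton (x := (0 : L))).submodule_topologicalClosure_eq,
        Submodule.mem_bot] at hmem
      have := (V i₀).norm_map e
      simp [hmem, he] at this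
    obtain ⟨F, hF, hFa⟩ := (hV.OrthogonalFamily.comp
      (Subtype.val_injective (p := (· ∈ S)))).exists_ampliation
    obtain ⟨G, hG, hGa⟩ := (hW.OrthogonalFamily.comp
      (Subtype.val_injective (p := (· ∈ S')))).exists_ampliation
    have hFG : LinearMap.range F.toLinearMap = LinearMap.range G.toLinearMap := by
      ext y
      rw [hF, hG, hSS]
    let T : lp (fun _ : ℕ => H) 2 ≃ₗᵢ[ℂ] lp (fun _ : ℕ => K) 2 :=
      (F.equivRange.trans (LinearIsometryEquiv.ofEq _ _ hFG)).trans G.equivRange.symm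
    have hT (x) : G (T x) = F x := by
      have h1 : G.equivRange (T x) = LinearIsometryEquiv.ofEq _ _ hFG (F.equivRange x) := by
        simp [T]
      exact congrArg Subtype.val h1
    refine ⟨T, fun k t x => G.injective ?_⟩
    rw [hT, ← hFa _ _ fun i h => hVπ _ _ _, ← hGa _ _ fun i h => hWρ _ _ _, hT, huv]

end TupleEquiv

/-! ### Absorption of a subspace in an infinite multiple -/

section Absorb

open scoped InnerProductSpace

variable {ι κ : Type*} {H : Type*} [NormedAddCommGroup H] [InnerProductSpace ℂ H]

/-- Restriction of square-summable families along an injection of the index sets. -/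
def lpComp (f : ι ↪ κ) : lp (fun _ : κ => H) 2 →ₗ[ℂ] lp (fun _ : ι => H) 2 where
  toFun x := ⟨fun i => x (f i), memℓp_two_iff.2
    ((lp.hasSum_norm_sq x).summable.comp_injective f.injective)⟩
  map_add' _ _ := rfl
  map_smul' _ _ := rfl

/-- Extension of square-summable families by zero along an injection of the index sets. -/
def lpExtend (f : ι ↪ κ) : lp (fun _ : ι => H) 2 →ₗ[ℂ] lp (fun _ : κ => H) 2 where
  toFun x := ⟨Function.extend f (x : ι → H) 0, memℓp_two_iff.2 <| by
    refine (f.injective.summable_iff fun j hj => ?_).1 ?_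
    · rw [Function.extend_apply' _ _ _ hj]; simp
    · refine (lp.hasSum_norm_sq x).summable.congr fun i => ?_
      simp [f.injective.extend_apply]⟩
  map_add' x y := by
    ext j
    change Function.extend f (fun i => x i + y i) 0 j =
      Function.extend f (x : ι → H) 0 j + Function.extend f (y : ι → H) 0 j
    by_cases hj : ∃ i, f i = j
    · obtain ⟨i, rfl⟩ := hj
      simp only [f.injective.extend_apply]
    · simp [Function.extend_apply' _ _ _ hj]
  map_smul' c x := by
    ext j
    by_cases hj : ∃ i, f i = j
    · obtain ⟨i, rfl⟩ := hj
      simp [f.injective.extend_apply]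
    · simp [Function.extend_apply' _ _ _ hj]

@[simp]
theorem lpExtend_apply (f : ι ↪ κ) (x : lp (fun _ : ι => H) 2) (i : ι) :
    lpExtend f x (f i) = x i :=
  f.injective.extend_apply _ _ _

theorem lpExtend_apply' (f : ι ↪ κ) (x : lp (fun _ : ι => H) 2) (j : κ) (hj : ¬ ∃ i, f i = j) :
    lpExtend f x j = 0 :=
  Function.extend_apply' _ _ _ hj

/-- The embedding of `ℕ` in itself as the even numbers. -/
def evenEmb : ℕ ↪ ℕ := ⟨fun n => 2 * n, fun _ _ h => by simpa using h⟩

/-- The embedding of `ℕ` in itself as the odd numbers. -/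
def oddEmb : ℕ ↪ ℕ := ⟨fun n => 2 * n + 1, fun _ _ h => by simpa using h⟩

theorem lpExtend_evenEmb_apply (x : lp (fun _ : ℕ => H) 2) (n : ℕ) :
    lpExtend evenEmb x (2 * n) = x n := lpExtend_apply evenEmb x n

theorem lpExtend_oddEmb_apply (x : lp (fun _ : ℕ => H) 2) (n : ℕ) :
    lpExtend oddEmb x (2 * n + 1) = x n := lpExtend_apply oddEmb x n

theorem lpExtend_evenEmb_apply_odd (x : lp (fun _ : ℕ => H) 2) (n : ℕ) :
    lpExtend evenEmb x (2 * n + 1) = 0 := by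
  refine lpExtend_apply' _ _ _ ?_
  rintro ⟨i, hi⟩
  have : 2 * i = 2 * n + 1 := hi
  omega

theorem lpExtend_oddEmb_apply_even (x : lp (fun _ : ℕ => H) 2) (n : ℕ) :
    lpExtend oddEmb x (2 * n) = 0 := by
  refine lpExtend_apply' _ _ _ ?_
  rintro ⟨i, hi⟩
  have : 2 * i + 1 = 2 * n := hi
  omega

variable {K : Type*} [NormedAddCommGroup K] [InnerProductSpace ℂ K] (M : Submodule ℂ K)
  [M.HasOrthogonalProjection]

theorem Submodule.starProjection_starProjection (x : K) :
    M.starProjection (M.starProjection x) = M.starProjection x :=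
  M.starProjection_eq_self_iff.2 (M.starProjection_apply_mem x)

theorem Submodule.starProjection_starProjection_orthogonal (x : K) :
    M.starProjection (Mᗮ.starProjection x) = 0 :=
  M.starProjection_apply_eq_zero_iff.2 (Mᗮ.starProjection_apply_mem x)

theorem Submodule.starProjection_orthogonal_starProjection (x : K) :
    Mᗮ.starProjection (M.starProjection x) = 0 :=
  Mᗮ.starProjection_apply_eq_zero_iff.2
    (M.le_orthogonal_orthogonal (M.starProjection_apply_mem x))

theorem Submodule.starProjection_orthogonal_coe (x : M) : Mᗮ.starProjection (x : K) = 0 :=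
  Mᗮ.starProjection_apply_eq_zero_iff.2 (M.le_orthogonal_orthogonal x.2)

theorem Submodule.starProjection_add_orthogonal (x : K) :
    M.starProjection x + Mᗮ.starProjection x = x :=
  (M.starProjection_add_starProjection_orthogonal x)

theorem norm_sq_eq_starProjection (x : K) :
    ‖x‖ ^ 2 = ‖M.starProjection x‖ ^ 2 + ‖Mᗮ.starProjection x‖ ^ 2 :=
  Submodule.norm_sq_eq_add_norm_sq_starProjection x M

/-- The norm identity for `absorb M`, by Pythagoras in each coordinate. -/
theorem norm_absorb_aux (y : lp (fun _ : ℕ => K) 2) :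
    ‖WithLp.toLp 2 (lpMap ℕ M.orthogonalProjectionOnto (lpComp evenEmb y),
      lpMap ℕ M.starProjection (lpComp oddEmb y) + lpMap ℕ Mᗮ.starProjection y)‖ = ‖y‖ := by
  have h1 := lp.hasSum_norm_sq (lpMap ℕ M.orthogonalProjectionOnto (lpComp evenEmb y))
  have h2 := lp.hasSum_norm_sq (lpMap ℕ M.starProjection (lpComp oddEmb y))
  have h3 := lp.hasSum_norm_sq (lpMap ℕ Mᗮ.starProjection y)
  have h4 := lp.hasSum_norm_sq (lpMap ℕ M.starProjection (lpComp oddEmb y) +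
    lpMap ℕ Mᗮ.starProjection y)
  have h5 := lp.hasSum_norm_sq y
  have h6 : HasSum (fun n => ‖M.starProjection (y n)‖ ^ 2)
      (‖lpMap ℕ M.orthogonalProjectionOnto (lpComp evenEmb y)‖ ^ 2 +
        ‖lpMap ℕ M.starProjection (lpComp oddEmb y)‖ ^ 2) := HasSum.even_add_odd h1 h2
  have h7 : ‖lpMap ℕ M.starProjection (lpComp oddEmb y) + lpMap ℕ Mᗮ.starProjection y‖ ^ 2 =
      ‖lpMap ℕ M.starProjection (lpComp oddEmb y)‖ ^ 2 +
        ‖lpMap ℕ Mᗮ.starProjection y‖ ^ 2 := by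
    refine h4.unique ?_
    convert h2.add h3 using 2 with n
    change ‖M.starProjection (y (2 * n + 1)) + Mᗮ.starProjection (y n)‖ ^ 2 =
      ‖M.starProjection (y (2 * n + 1))‖ ^ 2 + ‖Mᗮ.starProjection (y n)‖ ^ 2
    rw [norm_sq_eq_starProjection M, map_add, map_add, M.starProjection_starProjection,
      M.starProjection_starProjection_orthogonal, M.starProjection_orthogonal_starProjection,
      Mᗮ.starProjection_starProjection, add_zero, zero_add]
  have h8 := h5.unique (by
    convert h6.add h3 using 2 with n
    exact norm_sq_eq_starProjection M (y n))
  rw [← sq_eq_sq₀ (norm_nonneg _) (norm_nonneg _), WithLp.prod_norm_sq_eq_of_L2, h8, add_assoc,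
    ← h7]
  rfl

/-- The unitary operator `K ⊗ ℓ² → (M ⊗ ℓ²) ⊕ (K ⊗ ℓ²)` for a closed subspace `M` of `K`. As
`K = M ⊕ Mᗮ` and `ℕ` splits into the even and the odd numbers, `K ⊗ ℓ²` is the sum of two copies
of `M ⊗ ℓ²` and of `Mᗮ ⊗ ℓ²`; the first copy of `M ⊗ ℓ²` is split off. -/
def absorb : lp (fun _ : ℕ => K) 2 ≃ₗᵢ[ℂ]
    WithLp 2 (lp (fun _ : ℕ => M) 2 × lp (fun _ : ℕ => K) 2) where
  toFun y := WithLp.toLp 2 (lpMap ℕ M.orthogonalProjectionOnto (lpComp evenEmb y),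
    lpMap ℕ M.starProjection (lpComp oddEmb y) + lpMap ℕ Mᗮ.starProjection y)
  invFun z := lpExtend evenEmb (lpMap ℕ M.subtypeL z.fst) +
    lpExtend oddEmb (lpMap ℕ M.starProjection z.snd) + lpMap ℕ Mᗮ.starProjection z.snd
  map_add' x y := by
    simp only [map_add]
    rw [← WithLp.toLp_add, Prod.mk_add_mk]
    congr 2
    abel
  map_smul' c x := by
    simp only [map_smul, RingHom.id_apply]
    rw [← WithLp.toLp_smul, Prod.smul_mk, smul_add]
  left_inv y := by
    ext n
    rcases Nat.even_or_odd' n with ⟨m, rfl | rfl⟩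
    · change (lpExtend evenEmb _ : ℕ → K) _ + (lpExtend oddEmb _ : ℕ → K) _ + _ = _
      rw [lpExtend_evenEmb_apply, lpExtend_oddEmb_apply_even]
      change M.starProjection (y (2 * m)) + 0 + Mᗮ.starProjection
        (M.starProjection (y (2 * (2 * m) + 1)) + Mᗮ.starProjection (y (2 * m))) = _
      rw [map_add, M.starProjection_orthogonal_starProjection,
        Mᗮ.starProjection_starProjection, add_zero, zero_add, M.starProjection_add_orthogonal]
    · change (lpExtend evenEmb _ : ℕ → K) _ + (lpExtend oddEmb _ : ℕ → K) _ + _ = _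
      rw [lpExtend_evenEmb_apply_odd, lpExtend_oddEmb_apply]
      change 0 + M.starProjection
        (M.starProjection (y (2 * m + 1)) + Mᗮ.starProjection (y m)) + Mᗮ.starProjection
        (M.starProjection (y (2 * (2 * m + 1) + 1)) + Mᗮ.starProjection (y (2 * m + 1))) = _
      rw [map_add, map_add, M.starProjection_orthogonal_starProjection,
        M.starProjection_starProjection, M.starProjection_starProjection_orthogonal,
        Mᗮ.starProjection_starProjection, add_zero, zero_add, zero_add,
        M.starProjection_add_orthogonal]
  right_inv z := by
    refine WithLp.ofLp_injective 2 (Prod.ext ?_ ?_)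
    · ext n
      change M.starProjection ((lpExtend evenEmb _ : ℕ → K) (2 * n) +
        (lpExtend oddEmb _ : ℕ → K) (2 * n) + Mᗮ.starProjection (z.snd (2 * n))) = z.fst n
      rw [lpExtend_evenEmb_apply, lpExtend_oddEmb_apply_even, add_zero, map_add,
        M.starProjection_starProjection_orthogonal, add_zero]
      exact M.starProjection_mem_subspace_eq_self _
    · ext n
      change M.starProjection ((lpExtend evenEmb _ : ℕ → K) (2 * n + 1) +
          (lpExtend oddEmb _ : ℕ → K) (2 * n + 1) + Mᗮ.starProjection (z.snd (2 * n + 1))) +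
        Mᗮ.starProjection ((lpExtend evenEmb _ : ℕ → K) n + (lpExtend oddEmb _ : ℕ → K) n +
          Mᗮ.starProjection (z.snd n)) = z.snd n
      have h (n : ℕ) : Mᗮ.starProjection
          ((lpExtend evenEmb (lpMap ℕ M.subtypeL z.fst) : ℕ → K) n +
          (lpExtend oddEmb (lpMap ℕ M.starProjection z.snd) : ℕ → K) n) = 0 := by
        rcases Nat.even_or_odd' n with ⟨m, rfl | rfl⟩
        · rw [lpExtend_evenEmb_apply, lpExtend_oddEmb_apply_even, add_zero]
          exact M.starProjection_orthogonal_coe _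
        · rw [lpExtend_evenEmb_apply_odd, lpExtend_oddEmb_apply, zero_add]
          exact M.starProjection_orthogonal_starProjection _
      rw [lpExtend_evenEmb_apply_odd, lpExtend_oddEmb_apply, zero_add, map_add, map_add, h,
        lpMap_apply, M.starProjection_starProjection,
        M.starProjection_starProjection_orthogonal, Mᗮ.starProjection_starProjection,
        add_zero, zero_add, M.starProjection_add_orthogonal]
  norm_map' y := norm_absorb_aux M y

/-- If the compression of `V` to `M` is `θ`-close to `U` and the off-diagonal blocks of `V` have
norm at most `η`, then `V ⊗ 1` is `(2 * η + θ)`-close to `(U ⊗ 1) ⊕ (V ⊗ 1)`. The unitary operator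
`absorb M` intertwines the block diagonal part `D` of `V` exactly, that is, it carries `D ⊗ 1` to
`(D|_M ⊗ 1) ⊕ (D ⊗ 1)`. -/
theorem norm_absorb_sub_le (V : K →L[ℂ] K) (U : M →L[ℂ] M) {η θ : ℝ} (hη0 : 0 ≤ η) (hθ0 : 0 ≤ θ)
    (hη : ∀ x, ‖Mᗮ.starProjection (V (M.starProjection x))‖ ≤ η * ‖M.starProjection x‖)
    (hη' : ∀ x, ‖M.starProjection (V (Mᗮ.starProjection x))‖ ≤ η * ‖Mᗮ.starProjection x‖)
    (hθ : ∀ x : M, ‖M.orthogonalProjectionOnto (V x) - U x‖ ≤ θ * ‖x‖)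
    (y : lp (fun _ : ℕ => K) 2) :
    ‖absorb M (lpMap ℕ V y) - WithLp.toLp 2 (lpMap ℕ U (absorb M y).fst,
      lpMap ℕ V (absorb M y).snd)‖ ≤ (2 * η + θ) * ‖y‖ := by
  let O : K →L[ℂ] K := M.starProjection ∘L V ∘L Mᗮ.starProjection +
    Mᗮ.starProjection ∘L V ∘L M.starProjection
  let E : M →L[ℂ] M := M.orthogonalProjectionOnto ∘L V ∘L M.subtypeL - U
  have hO (x : K) : O x = M.starProjection (V (Mᗮ.starProjection x)) +
    Mᗮ.starProjection (V (M.starProjection x)) := rfl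
  have hPO (x : K) : M.starProjection (O x) = M.starProjection (V (Mᗮ.starProjection x)) := by
    rw [hO, map_add, M.starProjection_starProjection,
      M.starProjection_starProjection_orthogonal, add_zero]
  have hQO (x : K) : Mᗮ.starProjection (O x) = Mᗮ.starProjection (V (M.starProjection x)) := by
    rw [hO, map_add, Mᗮ.starProjection_starProjection,
      M.starProjection_orthogonal_starProjection, zero_add]
  have hOη : ‖O‖ ≤ η := by
    refine O.opNorm_le_bound hη0 fun x => ?_
    rw [← sq_le_sq₀ (norm_nonneg _) (by positivity), norm_sq_eq_starProjection M, hPO, hQO,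
      mul_pow, norm_sq_eq_starProjection M x]
    have h1 := pow_le_pow_left₀ (norm_nonneg _) (hη x) 2
    have h2 := pow_le_pow_left₀ (norm_nonneg _) (hη' x) 2
    rw [mul_pow] at h1 h2
    linarith
  have hEθ : ‖E‖ ≤ θ := E.opNorm_le_bound hθ0 hθ
  have heq : absorb M (lpMap ℕ V y) - WithLp.toLp 2 (lpMap ℕ U (absorb M y).fst,
      lpMap ℕ V (absorb M y).snd) = absorb M (lpMap ℕ O y) -
      WithLp.toLp 2 (0, lpMap ℕ O (absorb M y).snd) +
      WithLp.toLp 2 (lpMap ℕ E (absorb M y).fst, 0) := by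
    refine WithLp.ofLp_injective 2 (Prod.ext ?_ ?_)
    · ext n
      change M.starProjection (V (y (2 * n))) - (U (M.orthogonalProjectionOnto (y (2 * n))) : K) =
        M.starProjection (O (y (2 * n))) - 0 + (M.starProjection (V (M.starProjection (y (2 * n))))
          - U (M.orthogonalProjectionOnto (y (2 * n))))
      nth_rw 1 [← M.starProjection_add_orthogonal (y (2 * n))]
      rw [hPO, map_add, map_add]
      abel
    · ext n
      change M.starProjection (V (y (2 * n + 1))) + Mᗮ.starProjection (V (y n)) -
        V (M.starProjection (y (2 * n + 1)) + Mᗮ.starProjection (y n)) =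
        M.starProjection (O (y (2 * n + 1))) + Mᗮ.starProjection (O (y n)) -
        O (M.starProjection (y (2 * n + 1)) + Mᗮ.starProjection (y n)) + 0
      have h1 (x : K) : O (M.starProjection x) = Mᗮ.starProjection (V (M.starProjection x)) := by
        rw [hO, M.starProjection_orthogonal_starProjection, M.starProjection_starProjection,
          map_zero, map_zero, zero_add]
      have h2 (x : K) : O (Mᗮ.starProjection x) = M.starProjection (V (Mᗮ.starProjection x)) := by
        rw [hO, M.starProjection_starProjection_orthogonal, Mᗮ.starProjection_starProjection,
          map_zero, map_zero, add_zero]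
      have h3 (x : K) : V x = V (M.starProjection x) + V (Mᗮ.starProjection x) := by
        rw [← map_add, M.starProjection_add_orthogonal]
      have h4 : Mᗮ.starProjection (V (M.starProjection (y (2 * n + 1)))) =
          V (M.starProjection (y (2 * n + 1))) -
            M.starProjection (V (M.starProjection (y (2 * n + 1)))) :=
        eq_sub_of_add_eq' (M.starProjection_add_orthogonal _)
      have h5 : M.starProjection (V (Mᗮ.starProjection (y n))) =
          V (Mᗮ.starProjection (y n)) - Mᗮ.starProjection (V (Mᗮ.starProjection (y n))) :=
        eq_sub_of_add_eq (M.starProjection_add_orthogonal _)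
      rw [hPO, hQO, map_add, map_add, h1, h2, h3 (y (2 * n + 1)), h3 (y n), map_add, map_add, h4,
        h5]
      abel
  have hsnd : ‖(absorb M y).snd‖ ≤ ‖y‖ := by
    rw [← (absorb M).norm_map y]
    exact WithLp.norm_snd_le _ (absorb M y)
  have hfst : ‖(absorb M y).fst‖ ≤ ‖y‖ := by
    rw [← (absorb M).norm_map y]
    exact WithLp.norm_fst_le _ (absorb M y)
  rw [heq]
  refine (norm_add_le _ _).trans ((add_le_add_left (norm_sub_le _ _) _).trans ?_)
  rw [(absorb M).norm_map, WithLp.norm_toLp_snd, WithLp.norm_toLp_fst]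
  have h1 := norm_lpMap_apply_le (ι := ℕ) hOη y
  have h2 := norm_lpMap_apply_le (ι := ℕ) hOη (absorb M y).snd
  have h3 := norm_lpMap_apply_le (ι := ℕ) hEθ (absorb M y).fst
  have h4 := mul_le_mul_of_nonneg_left hsnd hη0
  have h5 := mul_le_mul_of_nonneg_left hfst hθ0
  linarith

end Absorb

/-! ### Compressions of one-parameter unitary groups for small times -/

section OneParam

open scoped InnerProductSpace
open Filter Topology

namespace OneParamUnitaryGroup

variable {H : Type*} [NormedAddCommGroup H] [InnerProductSpace ℂ H] [CompleteSpace H]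
  (u : OneParamUnitaryGroup H)

theorem op_zero : u.op 0 = 1 := by
  simp [op]

theorem op_add (s t : ℝ) : u.op (s + t) = u.op s * u.op t := by
  simp [op, ofAdd_add]

theorem norm_op_apply (t : ℝ) (x : H) : ‖u.op t x‖ = ‖x‖ :=
  Unitary.norm_map (u.toHom (Multiplicative.ofAdd t)) x

theorem op_neg_apply_op (t : ℝ) (x : H) : u.op (-t) (u.op t x) = x := by
  rw [← mul_apply_eq_comp, ← op_add, neg_add_cancel, op_zero, one_apply_eq_self]

theorem inner_op_op (t : ℝ) (x y : H) : ⟪u.op t x, u.op t y⟫_ℂ = ⟪x, y⟫_ℂ :=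
  Unitary.inner_map_map (u.toHom (Multiplicative.ofAdd t)) x y

theorem inner_op_right (t : ℝ) (x y : H) : ⟪x, u.op t y⟫_ℂ = ⟪u.op (-t) x, y⟫_ℂ := by
  rw [← u.inner_op_op t (u.op (-t) x) y]
  congr 1
  simpa using (u.op_neg_apply_op (-t) x).symm

theorem tendsto_inner_op (x : H) : Tendsto (fun t => (⟪x, u.op t x⟫_ℂ).re) (𝓝 0) (𝓝 (‖x‖ ^ 2)) := by
  have h : Continuous fun t => (⟪x, u.op t x⟫_ℂ).re :=
    Complex.continuous_re.comp (continuous_const.inner (u.strongly_continuous x))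
  have h0 := h.tendsto 0
  rw [u.op_zero, one_apply_eq_self] at h0
  convert h0 using 2
  rw [inner_self_eq_norm_sq_to_K]
  norm_cast

end OneParamUnitaryGroup

variable {K : Type*} [NormedAddCommGroup K] [InnerProductSpace ℂ K] {M : Submodule ℂ K}
  [CompleteSpace M]

/-- The effect of a compression by the factor `C ≤ exp s` with `s ≥ 0`. If `U` is `C` times the
compression of `V` to `M`, then `M` is nearly invariant under `V`. -/
theorem compression_estimates {U : M → M} {V : K → K} {C s : ℝ} (hC : 0 < C)
    (hCs : C ≤ Real.exp s) (hU : ∀ x, ‖U x‖ = ‖x‖) (hV : ∀ x, ‖V x‖ = ‖x‖)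
    (hUV : ∀ x : M, U x = M.orthogonalProjectionOnto ((C : ℂ) • V (x : K))) (x : M) :
    ‖Mᗮ.starProjection (V x)‖ ≤ √(2 * s) * ‖x‖ ∧
      ‖M.orthogonalProjectionOnto (V x) - U x‖ ≤ s * ‖x‖ := by
  rcases eq_or_ne x 0 with rfl | hx
  · have h1 : V 0 = 0 := by simpa using hV 0
    have h2 : U 0 = 0 := by simpa using hU 0
    simp [h1, h2, -Submodule.starProjection_orthogonal_val]
  have hxpos : 0 < ‖x‖ := norm_pos_iff.2 hx
  have hUV' : U x = (C : ℂ) • M.orthogonalProjectionOnto (V x) := by rw [hUV, map_smul]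
  have hnorm : ‖x‖ = C * ‖M.starProjection (V x)‖ := by
    rw [← hU x, hUV', norm_smul, Complex.norm_real, Real.norm_of_nonneg hC.le]
    rfl
  set P := ‖M.starProjection (V x)‖ with hP
  have hpyth : ‖x‖ ^ 2 = P ^ 2 + ‖Mᗮ.starProjection (V x)‖ ^ 2 := by
    rw [hP, ← norm_sq_eq_starProjection M, hV, Submodule.coe_norm]
  have hPle : P ≤ ‖x‖ := by
    rw [hP, Submodule.coe_norm, ← hV x]
    exact M.norm_starProjection_apply_le _
  have hPpos : 0 < P := by
    by_contra h
    nlinarith [norm_nonneg (M.starProjection (V x))]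
  have hC1 : 1 ≤ C := by
    by_contra h
    nlinarith
  -- `P = ‖x‖ / C ≥ exp (-s) * ‖x‖ ≥ (1 - s) * ‖x‖`
  have hexp : Real.exp (-s) * ‖x‖ ≤ P := by
    rw [hnorm, ← mul_assoc]
    have h : Real.exp (-s) * C ≤ 1 := by
      calc Real.exp (-s) * C ≤ Real.exp (-s) * Real.exp s := by gcongr
        _ = 1 := by rw [← Real.exp_add, neg_add_cancel, Real.exp_zero]
    nlinarith
  have hs1 : (1 - s) * ‖x‖ ≤ P := by
    refine le_trans ?_ hexp
    gcongr
    linarith [Real.add_one_le_exp (-s)]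
  have hs2 : (1 - 2 * s) * ‖x‖ ^ 2 ≤ P ^ 2 := by
    have h1 : (Real.exp (-s) * ‖x‖) ^ 2 ≤ P ^ 2 := by gcongr
    refine le_trans ?_ h1
    rw [mul_pow, ← Real.exp_nat_mul]
    gcongr
    have := Real.add_one_le_exp ((2 : ℕ) * (-s))
    push_cast at this ⊢
    linarith
  have hs0 : 0 ≤ s := by
    have := hC1.trans hCs
    rwa [Real.one_le_exp_iff] at this
  constructor
  · rw [← sq_le_sq₀ (norm_nonneg _) (by positivity), mul_pow, Real.sq_sqrt (by positivity)]
    linarith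
  · have h : M.orthogonalProjectionOnto (V x) - U x =
        ((1 - C : ℝ) : ℂ) • M.orthogonalProjectionOnto (V x) := by
      rw [hUV', Complex.ofReal_sub, sub_smul, Complex.ofReal_one, one_smul]
    rw [h, norm_smul, Complex.norm_real, Real.norm_eq_abs, abs_of_nonpos (by linarith)]
    change -(1 - C) * P ≤ _
    nlinarith

variable [CompleteSpace K]

/-- If `U(t)` is `C(t)` times the compression of `V(t)` to `M ≠ 0`, then `C(t)` is positive
for small `t`, because `U(t)` and `V(t)` tend strongly to the identity. -/
theorem eventually_pos_of_compression (U : OneParamUnitaryGroup M) (V : OneParamUnitaryGroup K)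
    (C : ℝ → ℝ) (hC : ∀ᶠ t in 𝓝 (0 : ℝ), ∀ x : M,
      U.op t x = M.orthogonalProjectionOnto ((C t : ℂ) • V.op t (x : K))) (x : M) (hx : x ≠ 0) :
    ∀ᶠ t in 𝓝 (0 : ℝ), 0 < C t := by
  have hx' : 0 < ‖x‖ ^ 2 := by positivity
  have hU := (U.tendsto_inner_op x).eventually_const_lt hx'
  have hV := (V.tendsto_inner_op (x : K)).eventually_const_lt hx'
  filter_upwards [hC, hU, hV] with t h1 h2 h3
  rw [h1, map_smul, inner_smul_right, Submodule.inner_orthogonalProjectionOnto_eq_of_mem_left,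
    Complex.re_ofReal_mul] at h2
  exact pos_of_mul_pos_left h2 h3.le

/-- For small `t`, the subspace `M` is nearly invariant under `V(t)`, in both directions, and the
compression of `V(t)` to `M` is close to `U(t)`. -/
theorem eventually_norm_compression_le (U : OneParamUnitaryGroup M) (V : OneParamUnitaryGroup K)
    (C : ℝ → ℝ) {c : ℝ} (hc : 0 ≤ c)
    (hC : ∀ᶠ t in 𝓝 (0 : ℝ), C t ≤ Real.exp (t ^ 2 * c) ∧ ∀ x : M,
      U.op t x = M.orthogonalProjectionOnto ((C t : ℂ) • V.op t (x : K))) :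
    ∀ᶠ t in 𝓝 (0 : ℝ), (∀ x : M, ‖Mᗮ.starProjection (V.op t x)‖ ≤ √(2 * c) * |t| * ‖x‖) ∧
      ∀ x : M, ‖M.orthogonalProjectionOnto (V.op t x) - U.op t x‖ ≤ t ^ 2 * c * ‖x‖ := by
  by_cases hM : ∃ x : M, x ≠ 0
  · obtain ⟨x₀, hx₀⟩ := hM
    filter_upwards [hC, eventually_pos_of_compression U V C (hC.mono fun t h => h.2) x₀ hx₀]
      with t h1 h2
    have h (x : M) := compression_estimates h2 h1.1 (U.norm_op_apply t) (V.norm_op_apply t) h1.2 x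
    have hsqrt : √(2 * (t ^ 2 * c)) = √(2 * c) * |t| := by
      rw [show 2 * (t ^ 2 * c) = 2 * c * t ^ 2 by ring, Real.sqrt_mul (by positivity),
        Real.sqrt_sq_eq_abs]
    rw [hsqrt] at h
    exact ⟨fun x => (h x).1, fun x => (h x).2⟩
  · push Not at hM
    refine Eventually.of_forall fun t => ⟨fun x => ?_, fun x => ?_⟩ <;> simp [hM x]

/-- A bound on the block `M → Mᗮ` of `V(-t)` is a bound on the block `Mᗮ → M` of its adjoint
`V(t)`. -/
theorem norm_starProjection_op_le {V : OneParamUnitaryGroup K} {t η : ℝ} (hη0 : 0 ≤ η)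
    (hη : ∀ x : M, ‖Mᗮ.starProjection (V.op (-t) x)‖ ≤ η * ‖x‖) (x : K) :
    ‖M.starProjection (V.op t (Mᗮ.starProjection x))‖ ≤ η * ‖Mᗮ.starProjection x‖ := by
  set w := M.orthogonalProjectionOnto (V.op t (Mᗮ.starProjection x)) with hw
  change ‖w‖ ≤ _
  rcases eq_or_ne w 0 with h0 | h0
  · rw [h0, norm_zero]
    positivity
  have h1 : (‖w‖ ^ 2 : ℂ) = ⟪Mᗮ.starProjection (V.op (-t) w), Mᗮ.starProjection x⟫_ℂ := by
    rw [Submodule.inner_starProjection_left_eq_right, Submodule.starProjection_starProjection,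
      ← V.inner_op_right, ← Submodule.inner_orthogonalProjectionOnto_eq_of_mem_left, ← hw]
    exact (inner_self_eq_norm_sq_to_K w).symm
  have h2 : ‖w‖ ^ 2 ≤ η * ‖w‖ * ‖Mᗮ.starProjection x‖ := by
    calc ‖w‖ ^ 2 = ‖(‖w‖ ^ 2 : ℂ)‖ := by simp
      _ ≤ ‖Mᗮ.starProjection (V.op (-t) w)‖ * ‖Mᗮ.starProjection x‖ := by
        rw [h1]
        exact norm_inner_le_norm _ _
      _ ≤ _ := by
        gcongr
        exact hη w
  have h3 : 0 < ‖w‖ := norm_pos_iff.2 h0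
  nlinarith

/-- The estimate for small times: `V ⊗ 1` and `(U ⊗ 1) ⊕ (V ⊗ 1)` differ, up to the unitary operator
`absorb M`, by at most `ε |t|`, for each `ε > 2 √(2c)`. -/
theorem eventually_norm_absorb_sub_le (U : OneParamUnitaryGroup M) (V : OneParamUnitaryGroup K)
    (C : ℝ → ℝ) {c ε : ℝ} (hc : 0 ≤ c) (hε : 2 * √(2 * c) < ε)
    (hC : ∀ᶠ t in 𝓝 (0 : ℝ), C t ≤ Real.exp (t ^ 2 * c) ∧ ∀ x : M,
      U.op t x = M.orthogonalProjectionOnto ((C t : ℂ) • V.op t (x : K))) :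
    ∀ᶠ t in 𝓝 (0 : ℝ), ∀ y : lp (fun _ : ℕ => K) 2,
      ‖absorb M (amp ℕ K (V.op t) y) - WithLp.toLp 2 (amp ℕ M (U.op t) (absorb M y).fst,
        amp ℕ K (V.op t) (absorb M y).snd)‖ ≤ ε * |t| * ‖y‖ := by
  have hloc := eventually_norm_compression_le U V C hc hC
  have hneg : Tendsto (fun t : ℝ => -t) (𝓝 0) (𝓝 0) := by
    simpa using (continuous_neg (G := ℝ)).tendsto 0
  have hsmall : ∀ᶠ t in 𝓝 (0 : ℝ), |t| * c < ε - 2 * √(2 * c) := by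
    have h : Tendsto (fun t : ℝ => |t| * c) (𝓝 0) (𝓝 0) := by
      have h : Continuous fun t : ℝ => |t| * c := by fun_prop
      simpa using h.tendsto 0
    exact h.eventually_lt_const (by linarith)
  filter_upwards [hloc, hneg.eventually hloc, hsmall] with t h1 h2 h3 y
  rw [abs_neg] at h2
  have hη0 : 0 ≤ √(2 * c) * |t| := by positivity
  refine (norm_absorb_sub_le M (V.op t) (U.op t) hη0 (θ := t ^ 2 * c) (by positivity)
    (fun x => h1.1 (M.orthogonalProjectionOnto x)) (norm_starProjection_op_le hη0 h2.1) h1.2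
    y).trans ?_
  gcongr
  have h4 : t ^ 2 * c = |t| * (|t| * c) := by rw [← mul_assoc, ← sq, sq_abs]
  rw [h4]
  nlinarith [abs_nonneg t]

end OneParam

/-! ### Approximate unitary equivalence -/

section NearlyConj

open scoped InnerProductSpace
open Filter Topology

variable {κ : Type*} {X Y Z X' Y' : Type*}
  [NormedAddCommGroup X] [InnerProductSpace ℂ X] [NormedAddCommGroup Y] [InnerProductSpace ℂ Y]
  [NormedAddCommGroup Z] [InnerProductSpace ℂ Z]
  [NormedAddCommGroup X'] [InnerProductSpace ℂ X'] [NormedAddCommGroup Y'] [InnerProductSpace ℂ Y']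

/-- Two tuples of time-dependent maps are unitarily conjugate up to an error `ε |t|` at time `t`,
uniformly on the unit ball. -/
def NearlyConj (ε : ℝ) (A : κ → ℝ → X → X) (B : κ → ℝ → Y → Y) : Prop :=
  ∃ T : X ≃ₗᵢ[ℂ] Y, ∀ k t x, ‖T (A k t x) - B k t (T x)‖ ≤ ε * |t| * ‖x‖

theorem NearlyConj.of_eq {A : κ → ℝ → X → X} {B : κ → ℝ → Y → Y} (T : X ≃ₗᵢ[ℂ] Y)
    (hT : ∀ k t x, T (A k t x) = B k t (T x)) : NearlyConj 0 A B :=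
  ⟨T, fun k t x => by simp [hT]⟩

theorem NearlyConj.symm {ε : ℝ} {A : κ → ℝ → X → X} {B : κ → ℝ → Y → Y}
    (h : NearlyConj ε A B) : NearlyConj ε B A := by
  obtain ⟨T, hT⟩ := h
  refine ⟨T.symm, fun k t y => ?_⟩
  have h1 := hT k t (T.symm y)
  rw [T.apply_symm_apply, T.symm.norm_map] at h1
  rwa [norm_sub_rev, ← T.norm_map, map_sub, T.apply_symm_apply]

theorem NearlyConj.trans {ε ε' : ℝ} {A : κ → ℝ → X → X} {B : κ → ℝ → Y → Y} {C : κ → ℝ → Z → Z}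
    (h : NearlyConj ε A B) (h' : NearlyConj ε' B C) : NearlyConj (ε + ε') A C := by
  obtain ⟨T, hT⟩ := h
  obtain ⟨S, hS⟩ := h'
  refine ⟨T.trans S, fun k t x => ?_⟩
  have h1 := hT k t x
  have h2 := hS k t (T x)
  rw [T.norm_map] at h2
  rw [← S.norm_map, map_sub] at h1
  calc ‖S (T (A k t x)) - C k t (S (T x))‖
      ≤ ‖S (T (A k t x)) - S (B k t (T x))‖ + ‖S (B k t (T x)) - C k t (S (T x))‖ :=
        norm_sub_le_norm_sub_add_norm_sub _ _ _
    _ ≤ (ε + ε') * |t| * ‖x‖ := by linarith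

/-- The Hilbert space direct sum of two tuples of time-dependent maps. -/
def prodAction (A : κ → ℝ → X → X) (B : κ → ℝ → Y → Y) :
    κ → ℝ → WithLp 2 (X × Y) → WithLp 2 (X × Y) :=
  fun k t z => WithLp.toLp 2 (A k t z.fst, B k t z.snd)

/-- The direct sum of two unitary operators. -/
def prodCongrL2 (T : X ≃ₗᵢ[ℂ] X') (S : Y ≃ₗᵢ[ℂ] Y') :
    WithLp 2 (X × Y) ≃ₗᵢ[ℂ] WithLp 2 (X' × Y') where
  toFun z := WithLp.toLp 2 (T z.fst, S z.snd)
  invFun z := WithLp.toLp 2 (T.symm z.fst, S.symm z.snd)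
  map_add' x y := WithLp.ofLp_injective 2 (Prod.ext (map_add T _ _) (map_add S _ _))
  map_smul' c x := WithLp.ofLp_injective 2 (Prod.ext (map_smul T c _) (map_smul S c _))
  left_inv z := WithLp.ofLp_injective 2
    (Prod.ext (T.symm_apply_apply _) (S.symm_apply_apply _))
  right_inv z := WithLp.ofLp_injective 2
    (Prod.ext (T.apply_symm_apply _) (S.apply_symm_apply _))
  norm_map' z := by
    rw [← sq_eq_sq₀ (norm_nonneg _) (norm_nonneg _), WithLp.prod_norm_sq_eq_of_L2,
      WithLp.prod_norm_sq_eq_of_L2, ← T.norm_map z.fst, ← S.norm_map z.snd]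
    rfl

/-- The exchange of the summands of a Hilbert space direct sum. -/
def prodCommL2 (X Y : Type*) [NormedAddCommGroup X] [InnerProductSpace ℂ X]
    [NormedAddCommGroup Y] [InnerProductSpace ℂ Y] :
    WithLp 2 (X × Y) ≃ₗᵢ[ℂ] WithLp 2 (Y × X) where
  toFun z := WithLp.toLp 2 (z.snd, z.fst)
  invFun z := WithLp.toLp 2 (z.snd, z.fst)
  map_add' x y := rfl
  map_smul' c x := rfl
  left_inv z := rfl
  right_inv z := rfl
  norm_map' z := by
    rw [← sq_eq_sq₀ (norm_nonneg _) (norm_nonneg _), WithLp.prod_norm_sq_eq_of_L2,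
      WithLp.prod_norm_sq_eq_of_L2, add_comm]
    rfl

/-- An estimate for small times between two one-parameter groups of isometries holds for all times,
because the error is subadditive in time. -/
theorem norm_intertwine_le_of_eventually {A : ℝ → X → X} {B : ℝ → Y → Y} (T : X ≃ₗᵢ[ℂ] Y) {ε : ℝ}
    (hA0 : ∀ x, A 0 x = x) (hA : ∀ s t x, A (s + t) x = A s (A t x)) (hAn : ∀ t x, ‖A t x‖ = ‖x‖)
    (hB0 : ∀ x, B 0 x = x) (hB : ∀ s t x, B (s + t) x = B s (B t x))
    (hBn : ∀ t x y, ‖B t x - B t y‖ = ‖x - y‖)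
    (h : ∀ᶠ t in 𝓝 (0 : ℝ), ∀ x, ‖T (A t x) - B t (T x)‖ ≤ ε * |t| * ‖x‖) (t : ℝ) (x : X) :
    ‖T (A t x) - B t (T x)‖ ≤ ε * |t| * ‖x‖ := by
  have hmul (t : ℝ) (ht : ∀ x, ‖T (A t x) - B t (T x)‖ ≤ ε * |t| * ‖x‖) (n : ℕ) (x : X) :
      ‖T (A (n * t) x) - B (n * t) (T x)‖ ≤ n * (ε * |t| * ‖x‖) := by
    induction n generalizing x with
    | zero => simp [hA0, hB0]
    | succ n ih =>
      have h1 := ih (A t x)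
      rw [hAn] at h1
      have h2 := hBn (n * t) (T (A t x)) (B t (T x))
      have h3 := ht x
      rw [Nat.cast_succ, add_one_mul, hA, hB, add_one_mul]
      refine (norm_sub_le_norm_sub_add_norm_sub _ (B (n * t) (T (A t x))) _).trans ?_
      rw [h2]
      gcongr
  have hlim : Tendsto (fun n : ℕ => t / n) atTop (𝓝 0) := tendsto_const_div_atTop_nhds_zero_nat t
  obtain ⟨n, hn, hn0⟩ := ((hlim.eventually h).and (eventually_ne_atTop 0)).exists
  have hn' : (n : ℝ) ≠ 0 := Nat.cast_ne_zero.2 hn0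
  have h1 := hmul (t / n) hn n x
  rw [mul_div_cancel₀ t hn', abs_div, Nat.abs_cast] at h1
  refine h1.trans_eq ?_
  field_simp

end NearlyConj

/-! ### Dilations yield approximate absorption -/

section Dilation

open scoped InnerProductSpace
open Filter Topology

variable {d : ℕ} {H H₁ H₂ : Type*}
  [NormedAddCommGroup H] [InnerProductSpace ℂ H] [CompleteSpace H]
  [NormedAddCommGroup H₁] [InnerProductSpace ℂ H₁] [CompleteSpace H₁]
  [NormedAddCommGroup H₂] [InnerProductSpace ℂ H₂] [CompleteSpace H₂]

/-- The tuple `u ⊗ 1` on `H ⊗ ℓ²(ℕ)`. -/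
def ampTuple (u : Fin d → OneParamUnitaryGroup H) :
    Fin d → ℝ → lp (fun _ : ℕ => H) 2 → lp (fun _ : ℕ => H) 2 :=
  fun k t => amp ℕ H ((u k).op t)

theorem amp_op_zero (u : OneParamUnitaryGroup H) (x : lp (fun _ : ℕ => H) 2) :
    amp ℕ H (u.op 0) x = x := by
  rw [u.op_zero, map_one, one_apply_eq_self]

theorem amp_op_add (u : OneParamUnitaryGroup H) (s t : ℝ) (x : lp (fun _ : ℕ => H) 2) :
    amp ℕ H (u.op (s + t)) x = amp ℕ H (u.op s) (amp ℕ H (u.op t) x) := by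
  rw [u.op_add, map_mul, mul_apply_eq_comp]

theorem norm_amp_op_apply (u : OneParamUnitaryGroup H) (t : ℝ) (x : lp (fun _ : ℕ => H) 2) :
    ‖amp ℕ H (u.op t) x‖ = ‖x‖ := by
  rw [← sq_eq_sq₀ (norm_nonneg _) (norm_nonneg _)]
  refine (lp.hasSum_norm_sq _).unique ?_
  simpa only [amp_apply, u.norm_op_apply] using lp.hasSum_norm_sq x

/-- If `U(t)` is `C(t)` times a compression of `V(t)`, then `V ⊗ 1` nearly absorbs `U ⊗ 1`. -/
theorem nearlyConj_of_compression {K : Type*} [NormedAddCommGroup K] [InnerProductSpace ℂ K]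
    [CompleteSpace K] {M : Submodule ℂ K} [CompleteSpace M] (U : Fin d → OneParamUnitaryGroup M)
    (V : Fin d → OneParamUnitaryGroup K) (C : ℝ → ℝ) {c ε : ℝ} (hc : 0 ≤ c)
    (hε : 2 * √(2 * c) < ε)
    (hC : ∀ᶠ t in 𝓝 (0 : ℝ), C t ≤ Real.exp (t ^ 2 * c) ∧ ∀ (k : Fin d) (x : M),
      (U k).op t x = M.orthogonalProjectionOnto ((C t : ℂ) • (V k).op t (x : K))) :
    NearlyConj ε (ampTuple V) (prodAction (ampTuple U) (ampTuple V)) := by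
  refine ⟨absorb M, fun k => norm_intertwine_le_of_eventually (absorb M) (amp_op_zero _)
    (amp_op_add _) (norm_amp_op_apply _) (fun z => ?_) (fun s t z => ?_) (fun t z w => ?_)
    (eventually_norm_absorb_sub_le (U k) (V k) C hc hε (hC.mono fun t h => ⟨h.1, h.2 k⟩))⟩
  · exact WithLp.ofLp_injective 2 (Prod.ext (amp_op_zero _ _) (amp_op_zero _ _))
  · exact WithLp.ofLp_injective 2 (Prod.ext (amp_op_add _ _ _ _) (amp_op_add _ _ _ _))
  · rw [← sq_eq_sq₀ (norm_nonneg _) (norm_nonneg _), WithLp.prod_norm_sq_eq_of_L2,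
      WithLp.prod_norm_sq_eq_of_L2, WithLp.sub_fst, WithLp.sub_fst, WithLp.sub_snd,
      WithLp.sub_snd, ← norm_amp_op_apply (U k) t (z.fst - w.fst),
      ← norm_amp_op_apply (V k) t (z.snd - w.snd), map_sub, map_sub]
    rfl

/-- If `u ≺_c v`, then `v ⊗ 1` nearly absorbs `u ⊗ 1`. -/
theorem DilatesWith.nearlyConj [TopologicalSpace.SeparableSpace H₁]
    [TopologicalSpace.SeparableSpace H₂] {u : Fin d → OneParamUnitaryGroup H₁}
    {v : Fin d → OneParamUnitaryGroup H₂} {c ε : ℝ} (h : DilatesWith c u v) (hc : 0 ≤ c)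
    (hε : 2 * √(2 * c) < ε) :
    NearlyConj ε (ampTuple v) (prodAction (ampTuple u) (ampTuple v)) := by
  obtain ⟨K, _, _, _, _, M, _, U, V, C, huU, hvV, hC⟩ := h
  obtain ⟨S, hS⟩ := huU.exists_unitary
  obtain ⟨T, hT⟩ := hvV.exists_unitary
  have h1 : NearlyConj 0 (ampTuple v) (ampTuple V) := .of_eq T hT
  have h2 : NearlyConj 0 (prodAction (ampTuple u) (ampTuple v))
      (prodAction (ampTuple U) (ampTuple V)) := .of_eq (prodCongrL2 S T) fun k t z =>
    WithLp.ofLp_injective 2 (Prod.ext (hS k t _) (hT k t _))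
  have h3 := (h1.trans (nearlyConj_of_compression U V C hc hε hC)).trans h2.symm
  rwa [zero_add, add_zero] at h3

/-- If `u ≺_c v` and `v ≺_c' u`, then `u` and `v` are nearly unitarily equivalent after infinite
ampliation, as both are then nearly equivalent to their direct sum. -/
theorem nearlyConj_of_dilatesWith [TopologicalSpace.SeparableSpace H₁]
    [TopologicalSpace.SeparableSpace H₂] {u : Fin d → OneParamUnitaryGroup H₁}
    {v : Fin d → OneParamUnitaryGroup H₂} {c c' ε : ℝ} (huv : DilatesWith c u v)
    (hvu : DilatesWith c' v u) (hc : 0 ≤ c) (hc' : 0 ≤ c') (hε : 2 * √(2 * c) < ε)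
    (hε' : 2 * √(2 * c') < ε) : NearlyConj (ε + ε) (ampTuple u) (ampTuple v) := by
  have hswap : NearlyConj 0 (prodAction (ampTuple v) (ampTuple u))
      (prodAction (ampTuple u) (ampTuple v)) := .of_eq (prodCommL2 _ _) fun _ _ _ => rfl
  have h := ((hvu.nearlyConj hc' hε').trans hswap).trans (huv.nearlyConj hc hε).symm
  rwa [add_zero] at h

end Dilation

/-! ### Separable models and the representations -/

section Separable

open scoped InnerProductSpace
open Filter Topology

theorem separableSpace_lp (H : Type*) [NormedAddCommGroup H] [InnerProductSpace ℂ H]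
    [TopologicalSpace.SeparableSpace H] :
    TopologicalSpace.SeparableSpace (lp (fun _ : ℕ => H) 2) := by
  rw [← TopologicalSpace.isSeparable_univ_iff]
  have hsep : TopologicalSpace.IsSeparable (⋃ n : ℕ, Set.range (lpSingle H n)) :=
    .iUnion fun n => TopologicalSpace.isSeparable_range (lpSingle H n).continuous
  refine (hsep.span (R := ℂ)).closure.mono fun x _ => ?_
  refine mem_closure_of_tendsto (lp.hasSum_single (by norm_num) x)
    (Eventually.of_forall fun s => Submodule.sum_mem _ fun n _ => Submodule.subset_span ?_)
  exact Set.mem_iUnion.2 ⟨n, x n, rfl⟩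

/-- A separable Hilbert space is isometrically isomorphic to one in the lowest universe. -/
theorem exists_linearIsometryEquiv_type (X : Type*) [NormedAddCommGroup X] [InnerProductSpace ℂ X]
    [CompleteSpace X] [TopologicalSpace.SeparableSpace X] :
    ∃ (L : Type) (_ : NormedAddCommGroup L) (_ : InnerProductSpace ℂ L) (_ : CompleteSpace L)
      (_ : TopologicalSpace.SeparableSpace L), Nonempty (L ≃ₗᵢ[ℂ] X) := by
  obtain ⟨w, b, -⟩ := exists_hilbertBasis ℂ X
  have hsum := b.orthonormal.isHilbertSum b.dense_span.ge
  have hw : Countable w := by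
    classical
    rw [← Set.countable_univ_iff]
    refine (hsum.countable_support_isometry (LinearIsometry.id (R := ℂ) (E := X))).mono
      fun j _ => show ∃ x, _ ≠ _ from ⟨b j, ?_⟩
    have h : hsum.linearIsometryEquiv.symm (lp.single 2 j 1) = b j := by
      rw [hsum.linearIsometryEquiv_symm_apply_single]
      simp
    rw [LinearIsometry.id_apply, ← h, LinearIsometryEquiv.apply_symm_apply,
      lp.single_apply_self]
    exact one_ne_zero
  let e := equivShrink.{0} w
  let b' : HilbertBasis (Shrink.{0} w) ℂ X := HilbertBasis.mk
    (b.orthonormal.comp e.symm e.symm.injective) (by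
      rw [Set.range_comp, e.symm.range_eq_univ, Set.image_univ]
      exact b.dense_span.ge)
  refine ⟨lp (fun _ : Shrink.{0} w => ℂ) 2, inferInstance, inferInstance, inferInstance,
    b'.repr.surjective.denseRange.separableSpace b'.repr.continuous, ⟨b'.repr.symm⟩⟩

variable {H L : Type*}
  [NormedAddCommGroup H] [InnerProductSpace ℂ H] [CompleteSpace H]
  [NormedAddCommGroup L] [InnerProductSpace ℂ L] [CompleteSpace L]

/-- The representation `a ↦ a ⊗ 1` of `B(H)`, transported from `ℓ²(ℕ, H)` to `L`. -/
def ampRep (W : L ≃ₗᵢ[ℂ] lp (fun _ : ℕ => H) 2) : (H →L[ℂ] H) →⋆ₐ[ℂ] (L →L[ℂ] L) :=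
  W.symm.conjStarAlgEquiv.toStarAlgHom.comp (amp ℕ H)

theorem apply_ampRep (W : L ≃ₗᵢ[ℂ] lp (fun _ : ℕ => H) 2) (a : H →L[ℂ] H) (x : L) :
    W (ampRep W a x) = amp ℕ H a (W x) :=
  W.apply_symm_apply _

theorem hasInfiniteMultiplicity_ampRep (W : L ≃ₗᵢ[ℂ] lp (fun _ : ℕ => H) 2) :
    HasInfiniteMultiplicity (ampRep W) :=
  ⟨ℕ, inferInstance, W, fun a x i => by rw [apply_ampRep, amp_apply]⟩

theorem isFaithfulNormalRep_ampRep (W : L ≃ₗᵢ[ℂ] lp (fun _ : ℕ => H) 2) :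
    IsFaithfulNormalRep (ampRep W) := by
  refine ⟨fun a b hab => ?_, isNormalRep_of_lp _ W fun a x i => by rw [apply_ampRep, amp_apply]⟩
  ext h
  have h1 (c : H →L[ℂ] H) : W (ampRep W c (W.symm (lpSingle H 0 h))) 0 = c h := by
    rw [apply_ampRep, amp_apply, W.apply_symm_apply, lpSingle_apply, lp.single_apply_self]
  rw [← h1 a, ← h1 b, hab]

end Separable

theorem exists_lt_of_iInf_lt {P : ℝ → Prop} {r : ℝ}
    (h : (⨅ (c : ℝ) (_ : 0 < c ∧ P c), ENNReal.ofReal c) < ENNReal.ofReal r) :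
    ∃ c, 0 < c ∧ P c ∧ c < r := by
  simp only [iInf_lt_iff] at h
  obtain ⟨c, hc, hcr⟩ := h
  exact ⟨c, hc.1, hc.2, (ENNReal.ofReal_lt_ofReal_iff_of_nonneg hc.1.le).1 hcr⟩

end

theorem mainTheorem3 {H₁ H₂ : Type*}
    [NormedAddCommGroup H₁] [InnerProductSpace ℂ H₁] [CompleteSpace H₁]
    [TopologicalSpace.SeparableSpace H₁]
    [NormedAddCommGroup H₂] [InnerProductSpace ℂ H₂] [CompleteSpace H₂]
    [TopologicalSpace.SeparableSpace H₂] {d : ℕ}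
    (u : Fin d → OneParamUnitaryGroup H₁) (v : Fin d → OneParamUnitaryGroup H₂)
    (δ : ℝ) (hδ : 0 < δ) (h : dilationDist u v ≤ ENNReal.ofReal δ) :
    ∃ (L : Type) (_ : NormedAddCommGroup L) (_ : InnerProductSpace ℂ L) (_ : CompleteSpace L)
      (_ : TopologicalSpace.SeparableSpace L)
      (π : (H₁ →L[ℂ] H₁) →⋆ₐ[ℂ] (L →L[ℂ] L)) (ρ : (H₂ →L[ℂ] H₂) →⋆ₐ[ℂ] (L →L[ℂ] L)),
      IsFaithfulNormalRep π ∧ HasInfiniteMultiplicity π ∧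
      IsFaithfulNormalRep ρ ∧ HasInfiniteMultiplicity ρ ∧
      ∀ (k : Fin d) (t : ℝ),
        ‖π ((u k).op t) - ρ ((v k).op t)‖ ≤ 5 * √2 * |t| * √δ := by
  -- the infima defining the distance need not be attained; the constant `5` leaves room for
  -- replacing `δ` by any number below `25 / 16 * δ`
  have hlt : ENNReal.ofReal δ < ENNReal.ofReal (3 / 2 * δ) :=
    (ENNReal.ofReal_lt_ofReal_iff_of_nonneg hδ.le).2 (by linarith)
  obtain ⟨c, hc, huv, hcδ⟩ := exists_lt_of_iInf_lt (((le_max_left _ _).trans h).trans_lt hlt)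
  obtain ⟨c', hc', hvu, hcδ'⟩ := exists_lt_of_iInf_lt (((le_max_right _ _).trans h).trans_lt hlt)
  have hε (c : ℝ) (hc : 0 < c) (hcδ : c < 3 / 2 * δ) : 2 * √(2 * c) < 5 / 2 * √2 * √δ := by
    refine lt_of_pow_lt_pow_left₀ 2 (by positivity) ?_
    rw [mul_pow, mul_pow, mul_pow, Real.sq_sqrt (by positivity), Real.sq_sqrt (by positivity),
      Real.sq_sqrt (by positivity)]
    linarith
  obtain ⟨T, hT⟩ := nearlyConj_of_dilatesWith huv hvu hc.le hc'.le (hε c hc hcδ) (hε c' hc' hcδ')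
  have := separableSpace_lp H₁
  obtain ⟨L, _, _, _, _, ⟨W⟩⟩ := exists_linearIsometryEquiv_type (lp (fun _ : ℕ => H₁) 2)
  refine ⟨L, inferInstance, inferInstance, inferInstance, inferInstance, ampRep W,
    ampRep (W.trans T), isFaithfulNormalRep_ampRep _, hasInfiniteMultiplicity_ampRep _,
    isFaithfulNormalRep_ampRep _, hasInfiniteMultiplicity_ampRep _, fun k t => ?_⟩
  refine ContinuousLinearMap.opNorm_le_bound _ (by positivity) fun x => ?_
  have h1 := hT k t (W x)
  rw [W.norm_map] at h1
  rw [sub_apply, ← (W.trans T).norm_map, map_sub, apply_ampRep (W.trans T),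
    LinearIsometryEquiv.trans_apply, LinearIsometryEquiv.trans_apply, apply_ampRep]
  refine h1.trans_eq ?_
  ring
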